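/- Let $H$ be a separable real or complex Hilbert space, and let $X_1,\dots,X_n$ be independent random compact self-adjoint operators on $H$ with $\mathbb{E}X_i=0$. Let $A_1,\dots,A_n$ be deterministic bounded self-adjoint operators on $H$ such that $X_i^2\preceq A_i^2$ almost surely for every $i$, where $\preceq$ is the Loewner order. Put $$S_i:=\sum_{j\le i}X_j\quad(1\le i\le n),\qquad V_n:=\frac12\sum_{i\le n}\bigl(A_i^2+\mathbb{E}X_i^2\bigr).$$ Write $\lambda_{\max}(T)$ for the maximum of the spectrum of a compact self-adjoint operator $T$, $\|\cdot\|$ for the operator norm, and $\operatorname{tr}(V_n)=\sum_j\langle e_j,V_ne_j\rangle\in[0,\infty]$ for the trace, where $(e_j)$ is any orthonormal basis of $H$. Let $\sigma>0$ be such that $\|V_n\|\le\sigma^2\le\operatorname{tr}(V_n)$. Then for every $r\ge 0$, $$\mathbb{P}\Bigl(\sup_{1\le i\le n}\lambda_{\max}(S_i)\ge r\Bigr)\le\frac{e}{e-1}\,\frac{\operatorname{tr}(V_n)}{\sigma^2}\,\exp\Bigl(-\frac{r^2}{2\sigma^2}\Bigr)$$ and $$\mathbb{P}\Bigl(\sup_{1\le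 i\le n}\|S_i\|\ge r\Bigr)\le 2\,\frac{\operatorname{tr}(V_n)}{\sigma^2}\,\exp\Bigl(-\frac{r^2}{2\sigma^2}\Bigr).$$ -/

import Mathlib

open MeasureTheory ProbabilityTheory
open scoped ENNReal

namespace OperatorHoeffding

section Operators

variable {𝕜 H : Type*} [RCLike 𝕜] [NormedAddCommGroup H] [InnerProductSpace 𝕜 H]

/-- The largest point `λ_max(T)` of the (real) spectrum of a self-adjoint operator `T`. -/
noncomputable def lambdaMax (T : H →L[𝕜] H) : ℝ :=
  sSup {x : ℝ | (x : 𝕜) ∈ spectrum 𝕜 T}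

/-- The trace `∑ⱼ ⟪eⱼ, T eⱼ⟫ ∈ [0, ∞]` of a positive operator `T`, computed in the orthonormal
(Hilbert) basis `e`.  For positive `T` the value is the same for every basis. -/
noncomputable def posTrace {ι : Type*} (e : HilbertBasis ι 𝕜 H) (T : H →L[𝕜] H) : ℝ≥0∞ :=
  ∑' j, ENNReal.ofReal (RCLike.re (inner 𝕜 (e j) (T (e j))))

end Operators

section Sums

variable {𝕜 H : Type*} [RCLike 𝕜] [NormedAddCommGroup H] [InnerProductSpace 𝕜 H]

/-- The partial sums: the one with index `i : Fin n` is the sum of all `X j` with `j ≤ i`, so the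
indices `0, …, n - 1` give `S₁, …, Sₙ`. -/
noncomputable def partialSum {Ω : Type*} {n : ℕ} (X : Fin n → Ω → H →L[𝕜] H) (i : Fin n) (ω : Ω) :
    H →L[𝕜] H :=
  ∑ j ∈ Finset.Iic i, X j ω

/-- `Vₙ = ½ ∑ᵢ (Aᵢ² + 𝔼 Xᵢ²)`, with the Bochner integral as expectation. -/
noncomputable def varianceProxy [NormedSpace ℝ H] [IsScalarTower ℝ 𝕜 H]
    {Ω : Type*} [MeasurableSpace Ω] (P : Measure Ω)
    {n : ℕ} (X : Fin n → Ω → H →L[𝕜] H) (A : Fin n → H →L[𝕜] H) : H →L[𝕜] H :=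
  (1 / 2 : ℝ) • ∑ i, (A i ^ 2 + ∫ ω, X i ω ^ 2 ∂P)

end Sums

end OperatorHoeffding

/-! Everything is proved for compressions to the span of finitely many basis vectors, with bounds
that do not see the dimension. There `X i` becomes a Hermitian matrix `Y i`. By Bessel's inequality
(`posSemidef_compress_sq_sub`) its square is dominated by the compression of `X i ^ 2`, hence by
that of `A i ^ 2`, so the compression V of Vₙ dominates ½ ∑ (Yᵢ² + 𝔼 Yᵢ²).

Put S = ∑ Yᵢ, m(θ) = 𝔼 tr(exp(θS) - 1 - θS) and τ = tr(Vₙ)/σ². The subtracted terms make the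
function vanish at 0, so tr(Vₙ)/σ² replaces the dimension. Exchanging one summand for an independent
copy and using the mean value trace inequality `rtr_sub_mul_sub_le` gives, for θ ≥ 0, m'(θ) = 𝔼 tr
S(exp(θS) - 1) ≤ θ 𝔼 tr V exp(θS) (`integral_rtr_sum_mul_le`). As 𝔼 tr VS = 0, V ≼ σ² and tr V ≤
τσ², this is at most θσ²(m(θ) + τ), and Grönwall's argument yields m(θ) ≤ τ(exp(θ²σ²/2) - 1).

Klein's inequality makes traces of convex functions of the partial sums a submartingale, so a
Doob-type inequality (`mul_measureReal_exists_le`) bounds the maximum by the final moment. With θ =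
r/σ² and u = r²/σ² the tail probability p satisfies (eᵘ - 1 - u) p ≤ τ(exp(u/2) - 1). Since p ≤ 1 ≤
τ, scalar calculus turns this into the bound with e/(e - 1). Averaging over ±θ replaces the
remainder by cosh - 1 and gives the two-sided bound with constant 2.

In H, both the largest spectral value and the norm are controlled by quadratic forms. A strict
inequality for a quadratic form is an open condition, hence visible on the span of finitely many
basis vectors; these events increase with the span, and continuity of measure followed by q ↑ r
finishes the proof. -/

namespace OperatorHoeffding

open scoped ComplexOrder

/-! ### Trace inequalities for functions of Hermitian matrices -/

section MatrixFunctions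

open Matrix

variable {𝕜 F : Type*} [RCLike 𝕜] [Fintype F]

/-- The real part of the trace. -/
noncomputable def rtr (M : Matrix F F 𝕜) : ℝ := RCLike.re M.trace

lemma rtr_add (M N : Matrix F F 𝕜) : rtr (M + N) = rtr M + rtr N := by simp [rtr]

lemma rtr_sub (M N : Matrix F F 𝕜) : rtr (M - N) = rtr M - rtr N := by simp [rtr]

lemma rtr_mul_comm (M N : Matrix F F 𝕜) : rtr (M * N) = rtr (N * M) := by
  rw [rtr, Matrix.trace_mul_comm, rtr]

variable [DecidableEq F]

/-- `Φ` is a continuous map on matrices which acts on Hermitian matrices by applying `φ` to the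
eigenvalues. -/
structure IsMatrixFun (φ : ℝ → ℝ) (Φ : Matrix F F 𝕜 → Matrix F F 𝕜) : Prop where
  continuous : Continuous Φ
  map_conj : ∀ (U : unitaryGroup F 𝕜) (d : F → ℝ),
    Φ (U * diagonal (fun i => (d i : 𝕜)) * (star U : unitaryGroup F 𝕜)) =
      U * diagonal (fun i => (φ (d i) : 𝕜)) * (star U : unitaryGroup F 𝕜)

lemma isMatrixFun_id : IsMatrixFun (fun x => x) (fun A : Matrix F F 𝕜 => A) :=
  ⟨continuous_id, fun _ _ => rfl⟩

lemma isMatrixFun_one : IsMatrixFun (fun _ => 1) (fun _ : Matrix F F 𝕜 => 1) :=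
  ⟨continuous_const, fun U d => by
    have : diagonal (fun _ : F => ((1 : ℝ) : 𝕜)) = 1 := by simp
    rw [this]; simp⟩

namespace IsMatrixFun

variable {φ ψ : ℝ → ℝ} {Φ Ψ : Matrix F F 𝕜 → Matrix F F 𝕜}

lemma add (h : IsMatrixFun φ Φ) (h' : IsMatrixFun ψ Ψ) :
    IsMatrixFun (fun x => φ x + ψ x) (fun A => Φ A + Ψ A) :=
  ⟨h.continuous.add h'.continuous, fun U d => by
    rw [h.map_conj, h'.map_conj, ← Matrix.add_mul, ← Matrix.mul_add, Matrix.diagonal_add]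
    simp⟩

lemma const_smul (h : IsMatrixFun φ Φ) (c : ℝ) :
    IsMatrixFun (fun x => c * φ x) (fun A => (c : 𝕜) • Φ A) :=
  ⟨h.continuous.const_smul (c : 𝕜), fun U d => by
    rw [h.map_conj, ← Matrix.smul_mul, ← Matrix.mul_smul, ← Matrix.diagonal_smul]
    congr 3; ext i; simp⟩

lemma sub (h : IsMatrixFun φ Φ) (h' : IsMatrixFun ψ Ψ) :
    IsMatrixFun (fun x => φ x - ψ x) (fun A => Φ A - Ψ A) :=
  ⟨h.continuous.sub h'.continuous, fun U d => by
    rw [h.map_conj, h'.map_conj, ← Matrix.sub_mul, ← Matrix.mul_sub, Matrix.diagonal_sub]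
    simp⟩

lemma mul (h : IsMatrixFun φ Φ) (h' : IsMatrixFun ψ Ψ) :
    IsMatrixFun (fun x => φ x * ψ x) (fun A => Φ A * Ψ A) :=
  ⟨h.continuous.mul h'.continuous, fun U d => by
    rw [h.map_conj, h'.map_conj]
    have : ((star U : unitaryGroup F 𝕜) : Matrix F F 𝕜) * (U : Matrix F F 𝕜) = 1 := by simp
    rw [show ∀ a b c d e f : Matrix F F 𝕜, a * b * c * (d * e * f) = a * (b * (c * d) * e) * f by
      intros; simp only [mul_assoc], this, mul_one, Matrix.diagonal_mul_diagonal]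
    simp⟩

end IsMatrixFun

open scoped Matrix.Norms.Operator in
lemma continuous_exp_matrix : Continuous (fun A : Matrix F F 𝕜 => NormedSpace.exp A) := by
  let _ : NormedAlgebra ℚ (Matrix F F 𝕜) := NormedAlgebra.restrictScalars ℚ 𝕜 _
  exact NormedSpace.exp_continuous

lemma isMatrixFun_exp (θ : ℝ) :
    IsMatrixFun (fun x => Real.exp (θ * x))
      (fun A : Matrix F F 𝕜 => NormedSpace.exp ((θ : 𝕜) • A)) := by
  refine ⟨continuous_exp_matrix.comp (continuous_id.const_smul (θ : 𝕜)), fun U d => ?_⟩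
  have hU : ((star U : unitaryGroup F 𝕜) : Matrix F F 𝕜) = (U : Matrix F F 𝕜)⁻¹ := by
    symm; apply Matrix.inv_eq_left_inv; simp
  have hu : IsUnit (U : Matrix F F 𝕜) := (Unitary.toUnits U).isUnit
  rw [hU, ← Matrix.smul_mul, ← Matrix.mul_smul, ← Matrix.diagonal_smul, Matrix.exp_conj _ _ hu,
    Matrix.exp_diagonal]
  congr 3
  ext i
  rw [Pi.coe_exp, Real.exp_eq_exp_ℝ, ← RCLike.algebraMap_eq_ofReal, 
    NormedSpace.algebraMap_exp_comm]
  simp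

lemma spectral_form {A : Matrix F F 𝕜} (hA : A.IsHermitian) :
    A = hA.eigenvectorUnitary * diagonal (fun i => (hA.eigenvalues i : 𝕜)) *
      (star hA.eigenvectorUnitary : unitaryGroup F 𝕜) := by
  conv_lhs => rw [hA.spectral_theorem]
  rfl

/-- Trace formula for products of functions of two Hermitian matrices: the weights are the squared
moduli of the inner products of the eigenvectors. -/
lemma exists_rtr_mul_eq {A B : Matrix F F 𝕜} (hA : A.IsHermitian) (hB : B.IsHermitian) :
    ∃ q : F → F → ℝ, (∀ i j, 0 ≤ q i j) ∧
      ∀ (φ ψ : ℝ → ℝ) (Φ Ψ : Matrix F F 𝕜 → Matrix F F 𝕜), IsMatrixFun φ Φ → IsMatrixFun ψ Ψ →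
        rtr (Φ A * Ψ B) = ∑ i, ∑ j, q i j * (φ (hA.eigenvalues i) * ψ (hB.eigenvalues j)) := by
  set U := hA.eigenvectorUnitary with hU
  set W := hB.eigenvectorUnitary with hW
  set a := hA.eigenvalues with ha
  set b := hB.eigenvalues with hb
  set Q : Matrix F F 𝕜 := star (U : Matrix F F 𝕜) * W with hQ
  -- The weights are fixed before φ and ψ, so a trace inequality that is linear in terms tr Φ(A)Ψ(B)
  -- reduces to a scalar inequality at each pair of eigenvalues.
  refine ⟨fun i j => RCLike.normSq (Q i j), fun i j => RCLike.normSq_nonneg _, ?_⟩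
  intro φ ψ Φ Ψ hΦ hΨ
  have h1 : Φ A = U * diagonal (fun i => (φ (a i) : 𝕜)) * star (U : Matrix F F 𝕜) := by
    conv_lhs => rw [spectral_form hA]
    exact hΦ.map_conj _ _
  have h2 : Ψ B = W * diagonal (fun i => (ψ (b i) : 𝕜)) * star (W : Matrix F F 𝕜) := by
    conv_lhs => rw [spectral_form hB]
    exact hΨ.map_conj _ _
  have h3 : (Φ A * Ψ B).trace =
      (diagonal (fun i => (φ (a i) : 𝕜)) * (Q * diagonal (fun i => (ψ (b i) : 𝕜)) * star Q)).trace := by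
    rw [h1, h2, hQ, star_mul, star_star]
    rw [show (U : Matrix F F 𝕜) * diagonal (fun i => (φ (a i) : 𝕜)) * star (U : Matrix F F 𝕜) *
      (W * diagonal (fun i => (ψ (b i) : 𝕜)) * star (W : Matrix F F 𝕜)) =
      U * (diagonal (fun i => (φ (a i) : 𝕜)) * star (U : Matrix F F 𝕜) *
      (W * diagonal (fun i => (ψ (b i) : 𝕜)) * star (W : Matrix F F 𝕜))) by simp only [mul_assoc],
      Matrix.trace_mul_comm]
    simp only [mul_assoc]
  rw [rtr, h3, Matrix.trace, map_sum]
  refine Finset.sum_congr rfl fun i _ => ?_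
  rw [Matrix.diag_apply, Matrix.diagonal_mul, Matrix.mul_apply, Finset.mul_sum, map_sum]
  refine Finset.sum_congr rfl fun j _ => ?_
  rw [Matrix.mul_diagonal, Matrix.star_apply]
  have : (φ (a i) : 𝕜) * (Q i j * (ψ (b j) : 𝕜) * star (Q i j)) =
      ((RCLike.normSq (Q i j) * (φ (a i) * ψ (b j)) : ℝ) : 𝕜) := by
    have := RCLike.mul_conj (Q i j)
    rw [RCLike.star_def, mul_right_comm (Q i j), this, RCLike.normSq_eq_def']
    push_cast; ring
  rw [this, RCLike.ofReal_re]

lemma IsMatrixFun.rtr_eq {φ : ℝ → ℝ} {Φ : Matrix F F 𝕜 → Matrix F F 𝕜} (h : IsMatrixFun φ Φ)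
    {A : Matrix F F 𝕜} (hA : A.IsHermitian) : rtr (Φ A) = ∑ i, φ (hA.eigenvalues i) := by
  conv_lhs => rw [spectral_form hA]
  rw [h.map_conj, rtr, Matrix.trace_mul_comm, ← mul_assoc]
  simp [Matrix.trace]

/-- The trace of the product of a positive semidefinite matrix with a nonnegative function of a
Hermitian matrix is nonnegative. -/
lemma IsMatrixFun.rtr_mul_nonneg {φ : ℝ → ℝ} {Φ : Matrix F F 𝕜 → Matrix F F 𝕜}
    (h : IsMatrixFun φ Φ) (hφ : ∀ x, 0 ≤ φ x) {A : Matrix F F 𝕜} (hA : A.IsHermitian)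
    {M : Matrix F F 𝕜} (hM : M.PosSemidef) : 0 ≤ rtr (M * Φ A) := by
  rw [spectral_form hA, h.map_conj, rtr, ← mul_assoc, Matrix.trace_mul_comm, ← mul_assoc,
    ← mul_assoc]
  have := hM.conjTranspose_mul_mul_same (hA.eigenvectorUnitary : Matrix F F 𝕜)
  rw [Matrix.trace, map_sum]
  refine Finset.sum_nonneg fun i _ => ?_
  rw [Matrix.diag_apply, Matrix.mul_diagonal, mul_comm, RCLike.re_ofReal_mul]
  exact mul_nonneg (hφ _) (RCLike.nonneg_iff.1 (this.diag_nonneg)).1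

/-- The mean value trace inequality. -/
lemma rtr_sub_mul_sub_le {φ ψ : ℝ → ℝ} {Φ Ψ : Matrix F F 𝕜 → Matrix F F 𝕜}
    (hΦ : IsMatrixFun φ Φ) (hΨ : IsMatrixFun ψ Ψ)
    (hφψ : ∀ a b, (a - b) * (φ a - φ b) ≤ 1 / 2 * ((a - b) ^ 2 * (ψ a + ψ b)))
    {A B : Matrix F F 𝕜} (hA : A.IsHermitian) (hB : B.IsHermitian) :
    rtr ((A - B) * (Φ A - Φ B)) ≤ 1 / 2 * rtr ((A - B) * (A - B) * (Ψ A + Ψ B)) := by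
  obtain ⟨q, hq, H⟩ := exists_rtr_mul_eq hA hB
  have I := isMatrixFun_id (𝕜 := 𝕜) (F := F)
  have O := isMatrixFun_one (𝕜 := 𝕜) (F := F)
  -- Cyclicity of the trace brings each term to the form (function of A) times (function of B),
  -- padded with 1 where one matrix is absent.
  have e1 : rtr ((A - B) * (Φ A - Φ B)) =
      rtr (A * Φ A * 1) - rtr (A * Φ B) - rtr (Φ A * B) + rtr (1 * (B * Φ B)) := by
    rw [rtr_mul_comm (Φ A) B, mul_one, one_mul, ← rtr_sub, ← rtr_sub, ← rtr_add]
    congr 1; noncomm_ring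
  have e2 : rtr ((A - B) * (A - B) * (Ψ A + Ψ B)) =
      rtr (A * A * Ψ A * 1) - rtr (Ψ A * A * B) - rtr (A * Ψ A * B) + rtr (Ψ A * (B * B)) +
        (rtr (A * A * Ψ B) - rtr (A * (B * Ψ B)) - rtr (A * (Ψ B * B)) + rtr (1 * (B * B * Ψ B))) := by
    rw [rtr_mul_comm (Ψ A) (B * B), rtr_mul_comm (A * Ψ A) B, mul_assoc (Ψ A),
      rtr_mul_comm (Ψ A), ← mul_assoc A (Ψ B) B, rtr_mul_comm (A * Ψ B) B, mul_one, one_mul]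
    simp only [← rtr_sub, ← rtr_add]
    congr 1; noncomm_ring
  rw [e1, e2, H _ _ _ _ (I.mul hΦ) O, H _ _ _ _ I hΦ, H _ _ _ _ hΦ I, H _ _ _ _ O (I.mul hΦ),
    H _ _ _ _ ((I.mul I).mul hΨ) O, H _ _ _ _ (hΨ.mul I) I, H _ _ _ _ (I.mul hΨ) I,
    H _ _ _ _ hΨ (I.mul I), H _ _ _ _ (I.mul I) hΨ, H _ _ _ _ I (I.mul hΨ),
    H _ _ _ _ I (hΨ.mul I), H _ _ _ _ O ((I.mul I).mul hΨ)]
  simp only [← Finset.sum_sub_distrib, ← Finset.sum_add_distrib, Finset.mul_sum]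
  refine Finset.sum_le_sum fun i _ => Finset.sum_le_sum fun j _ => ?_
  have := mul_le_mul_of_nonneg_left (hφψ (hA.eigenvalues i) (hB.eigenvalues j)) (hq i j)
  linarith

/-- Klein's inequality. -/
lemma rtr_klein {φ ψ : ℝ → ℝ} {Φ Ψ : Matrix F F 𝕜 → Matrix F F 𝕜}
    (hΦ : IsMatrixFun φ Φ) (hΨ : IsMatrixFun ψ Ψ)
    (hφψ : ∀ a b, φ a + ψ a * (b - a) ≤ φ b)
    {A B : Matrix F F 𝕜} (hA : A.IsHermitian) (hB : B.IsHermitian) :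
    rtr (Φ A) + rtr (Ψ A * (B - A)) ≤ rtr (Φ B) := by
  obtain ⟨q, hq, H⟩ := exists_rtr_mul_eq hA hB
  have I := isMatrixFun_id (𝕜 := 𝕜) (F := F)
  have O := isMatrixFun_one (𝕜 := 𝕜) (F := F)
  have e1 : rtr (Ψ A * (B - A)) = rtr (Ψ A * B) - rtr (Ψ A * A * 1) := by
    rw [mul_one, ← rtr_sub, mul_sub]
  rw [← mul_one (Φ A), ← one_mul (Φ B), e1, H _ _ _ _ hΦ O, H _ _ _ _ hΨ I,
    H _ _ _ _ (hΨ.mul I) O, H _ _ _ _ O hΦ]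
  simp only [← Finset.sum_sub_distrib, ← Finset.sum_add_distrib]
  refine Finset.sum_le_sum fun i _ => Finset.sum_le_sum fun j _ => ?_
  have := mul_le_mul_of_nonneg_left (hφψ (hA.eigenvalues i) (hB.eigenvalues j)) (hq i j)
  linarith

/-- If the quadratic form of a Hermitian matrix exceeds `r` times the squared norm somewhere, then
some eigenvalue exceeds `r`. -/
lemma exists_eigenvalue_gt {A : Matrix F F 𝕜} (hA : A.IsHermitian) {r : ℝ} {c : F → 𝕜}
    (h : r * RCLike.re (star c ⬝ᵥ c) < RCLike.re (star c ⬝ᵥ (A *ᵥ c))) :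
    ∃ i, r < hA.eigenvalues i := by
  by_contra! hle
  set U := (hA.eigenvectorUnitary : Matrix F F 𝕜)
  -- Used twice: with the eigenvalues for the quadratic form of A, and with the constant 1 for the
  -- squared norm of c.
  have key : ∀ d : F → ℝ, star c ⬝ᵥ ((U * diagonal (fun i => (d i : 𝕜)) * star U) *ᵥ c) =
      ((∑ i, d i * RCLike.normSq ((star U *ᵥ c) i) : ℝ) : 𝕜) := by
    intro d
    rw [← Matrix.mulVec_mulVec, ← Matrix.mulVec_mulVec, Matrix.dotProduct_mulVec]
    have : star c ᵥ* U = star (star U *ᵥ c) := by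
      rw [Matrix.star_mulVec, star_eq_conjTranspose, conjTranspose_conjTranspose]
    rw [this, dotProduct]
    push_cast
    refine Finset.sum_congr rfl fun i _ => ?_
    rw [Matrix.mulVec_diagonal, Pi.star_apply, RCLike.star_def, mul_left_comm, RCLike.conj_mul,
      RCLike.normSq_eq_def']
    push_cast; ring
  have h1 := key hA.eigenvalues
  have h2 := key (fun _ => 1)
  have hone : (U * diagonal (fun _ => ((1 : ℝ) : 𝕜)) * star U) = 1 := by simp [U]
  have hA' : U * diagonal (fun i => (hA.eigenvalues i : 𝕜)) * star U = A := (spectral_form hA).symm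
  rw [hone, one_mulVec] at h2
  rw [hA'] at h1
  rw [h1, h2, RCLike.ofReal_re, RCLike.ofReal_re, Finset.mul_sum] at h
  refine absurd h (not_lt.2 (Finset.sum_le_sum fun i _ => ?_))
  rw [one_mul]
  exact mul_le_mul_of_nonneg_right (hle i) (RCLike.normSq_nonneg _)

end MatrixFunctions

/-! ### Bounded random matrices and the exchangeable pair -/

section RandomMatrices

open Matrix

variable {𝕜 F : Type*} [RCLike 𝕜]

noncomputable instance : MeasurableSpace (Matrix F F 𝕜) := borel _

instance : BorelSpace (Matrix F F 𝕜) := ⟨rfl⟩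

instance [Finite F] : SecondCountableTopology (Matrix F F 𝕜) :=
  inferInstanceAs (SecondCountableTopology (F → F → 𝕜))

lemma continuous_rtr [Fintype F] : Continuous (rtr : Matrix F F 𝕜 → ℝ) :=
  RCLike.continuous_re.comp (continuous_id.matrix_trace)

variable {Ω : Type*} [MeasurableSpace Ω] {P : Measure Ω}

/-- The integrable function `f` has integral `v`. -/
def HasMean (P : Measure Ω) (f : Ω → ℝ) (v : ℝ) : Prop := Integrable f P ∧ ∫ ω, f ω ∂P = v

namespace HasMean

variable {f g : Ω → ℝ} {u v : ℝ}

lemma const [IsProbabilityMeasure P] (c : ℝ) : HasMean P (fun _ => c) c :=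
  ⟨integrable_const _, by simp⟩

lemma add (hf : HasMean P f u) (hg : HasMean P g v) : HasMean P (fun ω => f ω + g ω) (u + v) :=
  ⟨hf.1.add hg.1, by rw [integral_add hf.1 hg.1, hf.2, hg.2]⟩

lemma sub (hf : HasMean P f u) (hg : HasMean P g v) : HasMean P (fun ω => f ω - g ω) (u - v) :=
  ⟨hf.1.sub hg.1, by rw [integral_sub hf.1 hg.1, hf.2, hg.2]⟩

lemma const_mul (hf : HasMean P f u) (c : ℝ) : HasMean P (fun ω => c * f ω) (c * u) :=
  ⟨hf.1.const_mul c, by rw [integral_const_mul, hf.2]⟩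

lemma mono (hf : HasMean P f u) (hg : HasMean P g v) (h : ∀ ω, f ω ≤ g ω) : u ≤ v := by
  rw [← hf.2, ← hg.2]
  exact integral_mono hf.1 hg.1 h

end HasMean

/-- A measurable random matrix with values in a compact set. -/
def IsBounded (Z : Ω → Matrix F F 𝕜) : Prop :=
  Measurable Z ∧ ∃ K, IsCompact K ∧ ∀ ω, Z ω ∈ K

namespace IsBounded

variable {Y Z : Ω → Matrix F F 𝕜}

lemma const (C : Matrix F F 𝕜) : IsBounded (fun _ : Ω => C) :=
  ⟨measurable_const, {C}, isCompact_singleton, fun _ => rfl⟩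

lemma comp (h : IsBounded Z) {Φ : Matrix F F 𝕜 → Matrix F F 𝕜} (hΦ : Continuous Φ) :
    IsBounded (fun ω => Φ (Z ω)) := by
  obtain ⟨hm, K, hK, hZ⟩ := h
  exact ⟨hΦ.measurable.comp hm, Φ '' K, hK.image hΦ, fun ω => ⟨_, hZ ω, rfl⟩⟩

lemma neg (h : IsBounded Y) : IsBounded (fun ω => - Y ω) := h.comp continuous_neg

lemma indicator (h : IsBounded Z) {s : Set Ω} (hs : MeasurableSet s) :
    IsBounded (s.indicator Z) := by
  obtain ⟨hm, K, hK, hZ⟩ := h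
  refine ⟨hm.indicator hs, insert 0 K, hK.insert 0, fun ω => ?_⟩
  by_cases hω : ω ∈ s
  · simpa [hω] using Or.inr (hZ ω)
  · simp [hω]

lemma integrable_comp [IsFiniteMeasure P] {E : Type*} [NormedAddCommGroup E] [MeasurableSpace E] [BorelSpace E]
    [SecondCountableTopology E] (h : IsBounded Z) {f : Matrix F F 𝕜 → E} (hf : Continuous f) :
    Integrable (fun ω => f (Z ω)) P := by
  obtain ⟨hm, K, hK, hZ⟩ := h
  obtain ⟨C, hC⟩ := hK.exists_bound_of_continuousOn hf.continuousOn
  exact Integrable.of_bound (hf.measurable.comp hm).aestronglyMeasurable C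
    (Filter.Eventually.of_forall fun ω => hC _ (hZ ω))

variable [Fintype F]

lemma comp₂ (h : IsBounded Y) (h' : IsBounded Z) {Φ : Matrix F F 𝕜 × Matrix F F 𝕜 → Matrix F F 𝕜}
    (hΦ : Continuous Φ) : IsBounded (fun ω => Φ (Y ω, Z ω)) := by
  obtain ⟨hm, K, hK, hY⟩ := h
  obtain ⟨hm', K', hK', hZ⟩ := h'
  exact ⟨hΦ.measurable.comp (hm.prodMk hm'), Φ '' (K ×ˢ K'), (hK.prod hK').image hΦ,
    fun ω => ⟨_, ⟨hY ω, hZ ω⟩, rfl⟩⟩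

lemma add (h : IsBounded Y) (h' : IsBounded Z) : IsBounded (fun ω => Y ω + Z ω) :=
  h.comp₂ h' continuous_add

lemma mul (h : IsBounded Y) (h' : IsBounded Z) : IsBounded (fun ω => Y ω * Z ω) :=
  h.comp₂ h' continuous_mul

lemma sum {ι : Type*} {Y : ι → Ω → Matrix F F 𝕜} (s : Finset ι) (h : ∀ i, IsBounded (Y i)) :
    IsBounded (fun ω => ∑ i ∈ s, Y i ω) := by
  classical
  induction s using Finset.induction_on with
  | empty => simpa using const 0
  | insert a s ha ih =>
    simp only [Finset.sum_insert ha]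
    exact (h a).add ih

lemma integrable_rtr [IsFiniteMeasure P] (h : IsBounded Z) : Integrable (fun ω => rtr (Z ω)) P :=
  h.integrable_comp continuous_rtr

end IsBounded

variable [Fintype F] [IsProbabilityMeasure P]

/-- The entrywise expectation of a random matrix. -/
noncomputable def matExp (P : Measure Ω) (Z : Ω → Matrix F F 𝕜) : Matrix F F 𝕜 :=
  Matrix.of fun i j => ∫ ω, Z ω i j ∂P

lemma integral_rtr_mul {Z : Ω → Matrix F F 𝕜} (h : IsBounded Z) (C : Matrix F F 𝕜) :
    ∫ ω, rtr (C * Z ω) ∂P = rtr (C * matExp P Z) := by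
  have hi : ∀ i j, Integrable (fun ω => Z ω i j) P := fun i j =>
    h.integrable_comp (f := fun M => M i j) (continuous_id.matrix_elem i j)
  have hs : ∀ i, Integrable (fun ω => ∑ j, C i j * Z ω j i) P := fun i =>
    integrable_finsetSum _ fun j _ => (hi j i).const_mul _
  simp only [rtr, Matrix.trace, Matrix.diag_apply, Matrix.mul_apply, matExp, Matrix.of_apply]
  rw [integral_re (integrable_finsetSum _ fun i _ => hs i), integral_finsetSum _ fun i _ => hs i]
  congr 1
  refine Finset.sum_congr rfl fun i _ => ?_
  rw [integral_finsetSum _ fun j _ => (hi j i).const_mul _]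
  exact Finset.sum_congr rfl fun j _ => integral_const_mul _ _

lemma IsBounded.hasMean_rtr {Z : Ω → Matrix F F 𝕜} (h : IsBounded Z) :
    HasMean P (fun ω => rtr (Z ω)) (∫ ω, rtr (Z ω) ∂P) := ⟨h.integrable_rtr, rfl⟩

lemma IsBounded.hasMean_rtr_mul {Z : Ω → Matrix F F 𝕜} (h : IsBounded Z) (C : Matrix F F 𝕜) :
    HasMean P (fun ω => rtr (C * Z ω)) (rtr (C * matExp P Z)) :=
  ⟨((IsBounded.const C).mul h).integrable_rtr, integral_rtr_mul h C⟩

/-- Integration of a continuous function of two independent bounded random matrices. -/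
lemma integral_eq_of_indepFun {Y W : Ω → Matrix F F 𝕜} (hY : IsBounded Y) (hW : IsBounded W)
    (hYW : IndepFun Y W P) {f : Matrix F F 𝕜 × Matrix F F 𝕜 → ℝ} (hf : Continuous f) :
    ∫ ω, f (Y ω, W ω) ∂P = ∫ ω', ∫ ω, f (Y ω, W ω') ∂P ∂P ∧
      Integrable (fun ω' => ∫ ω, f (Y ω, W ω') ∂P) P := by
  have hWY := hYW.symm
  rw [indepFun_iff_map_prod_eq_prod_map_map hW.1.aemeasurable hY.1.aemeasurable] at hWY
  have hm : Measurable fun ω => (W ω, Y ω) := hW.1.prodMk hY.1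
  have hfs : Continuous fun p : Matrix F F 𝕜 × Matrix F F 𝕜 => f (p.2, p.1) :=
    hf.comp continuous_swap
  obtain ⟨-, K, hK, hYK⟩ := id hY
  obtain ⟨-, K', hK', hWK⟩ := id hW
  obtain ⟨C, hC⟩ := (hK.prod hK').exists_bound_of_continuousOn hf.continuousOn
  have hint : Integrable (fun p : Ω × Ω => f (Y p.2, W p.1)) (P.prod P) :=
    Integrable.of_bound (hf.measurable.comp
      ((hY.1.comp measurable_snd).prodMk (hW.1.comp measurable_fst))).aestronglyMeasurable C
      (Filter.Eventually.of_forall fun p => hC _ ⟨hYK _, hWK _⟩)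
  refine ⟨?_, hint.integral_prod_left⟩
  have e1 : ∫ ω, f (Y ω, W ω) ∂P =
      ∫ p, f (p.2, p.1) ∂(P.map fun ω => (W ω, Y ω)) := by
    rw [integral_map hm.aemeasurable hfs.measurable.aestronglyMeasurable]
  rw [e1, hWY, Measure.map_prod_map _ _ hW.1 hY.1,
    integral_map (hW.1.prodMap hY.1).aemeasurable
      hfs.measurable.aestronglyMeasurable]
  exact integral_prod _ hint

variable [DecidableEq F]

/-- The exchangeable pair estimate for one summand. -/
lemma integral_rtr_mul_le {φ ψ : ℝ → ℝ} {Φ Ψ : Matrix F F 𝕜 → Matrix F F 𝕜}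
    (hΦ : IsMatrixFun φ Φ) (hΨ : IsMatrixFun ψ Ψ)
    (hφψ : ∀ a b, (a - b) * (φ a - φ b) ≤ 1 / 2 * ((a - b) ^ 2 * (ψ a + ψ b)))
    {Y : Ω → Matrix F F 𝕜} (hY : IsBounded Y) (hYH : ∀ ω, (Y ω).IsHermitian)
    (hY0 : matExp P Y = 0) {w : Matrix F F 𝕜} (hw : w.IsHermitian) :
    ∫ ω, rtr (Y ω * Φ (Y ω + w)) ∂P ≤
      1 / 2 * ∫ ω, rtr ((Y ω * Y ω + matExp P (fun ω => Y ω * Y ω)) * Ψ (Y ω + w)) ∂P := by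
  set M := matExp P (fun ω => Y ω * Y ω) with hM
  have bΦ : IsBounded (fun ω => Φ (Y ω + w)) :=
    (hY.add (IsBounded.const w)).comp hΦ.continuous
  have bΨ : IsBounded (fun ω => Ψ (Y ω + w)) :=
    (hY.add (IsBounded.const w)).comp hΨ.continuous
  have ha := (hY.mul bΦ).hasMean_rtr (P := P)
  have hb := ((hY.mul hY).mul bΨ).hasMean_rtr (P := P)
  set a := ∫ ω, rtr (Y ω * Φ (Y ω + w)) ∂P
  set b := ∫ ω, rtr (Y ω * Y ω * Ψ (Y ω + w)) ∂P
  have hzero : ∀ C : Matrix F F 𝕜, HasMean P (fun ω => rtr (C * Y ω)) 0 := fun C => by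
    have := hY.hasMean_rtr_mul (P := P) C
    rw [hY0, mul_zero] at this
    simpa [rtr] using this
  have hzero' : ∀ C : Matrix F F 𝕜, HasMean P (fun ω => rtr (Y ω * C)) 0 := fun C => by
    simpa only [rtr_mul_comm C] using hzero C
  set EΦ := matExp P (fun ω => Φ (Y ω + w))
  set EΨ := matExp P (fun ω => Ψ (Y ω + w))
  set E1 := matExp P (fun ω => Y ω * Ψ (Y ω + w))
  set E2 := matExp P (fun ω => Ψ (Y ω + w) * Y ω)
  -- The point ω' carries an independent copy of Y. The mean value inequality for Y(ω) + w and Y(ω')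
  -- + w is integrated over ω here and over ω' below. Centering kills the mixed terms, leaving 2a ≤
  -- ½(2b + 2 tr(EΨ M)).
  have key : ∀ ω', a - 0 - rtr (Y ω' * EΦ) + rtr (Y ω' * Φ (Y ω' + w)) ≤
      1 / 2 * (b - rtr (Y ω' * E2) - rtr (Y ω' * E1) + rtr (Y ω' * Y ω' * EΨ) +
        rtr (Ψ (Y ω' + w) * M) - 0 - 0 + rtr (Y ω' * Y ω' * Ψ (Y ω' + w))) := by
    intro ω'
    have pw := fun ω => rtr_sub_mul_sub_le hΦ hΨ hφψ ((hYH ω).add hw) ((hYH ω').add hw)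
    simp only [add_sub_add_right_eq_sub] at pw
    generalize Φ (Y ω' + w) = f at *
    generalize Ψ (Y ω' + w) = g at *
    generalize Y ω' = y at *
    have e1 := ((ha.sub (hzero f)).sub (bΦ.hasMean_rtr_mul y)).add (HasMean.const (rtr (y * f)))
    have e2 := ((((((((hb.sub ((bΨ.mul hY).hasMean_rtr_mul y)).sub
      ((hY.mul bΨ).hasMean_rtr_mul y)).add (bΨ.hasMean_rtr_mul (y * y))).add
      ((hY.mul hY).hasMean_rtr_mul g)).sub (hzero (y * g))).sub (hzero (g * y))).add
      (HasMean.const (rtr (y * y * g)))).const_mul (1 / 2))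
    refine e1.mono e2 fun ω => ?_
    have r1 : rtr ((Y ω - y) * (Φ (Y ω + w) - f)) =
        rtr (Y ω * Φ (Y ω + w)) - rtr (f * Y ω) - rtr (y * Φ (Y ω + w)) + rtr (y * f) := by
      rw [rtr_mul_comm f, ← rtr_sub, ← rtr_sub, ← rtr_add]
      congr 1; noncomm_ring
    have r2 : rtr ((Y ω - y) * (Y ω - y) * (Ψ (Y ω + w) + g)) =
        rtr (Y ω * Y ω * Ψ (Y ω + w)) - rtr (y * (Ψ (Y ω + w) * Y ω)) -
        rtr (y * (Y ω * Ψ (Y ω + w))) + rtr (y * y * Ψ (Y ω + w)) + rtr (g * (Y ω * Y ω)) -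
        rtr (y * g * Y ω) - rtr (g * y * Y ω) + rtr (y * y * g) := by
      rw [rtr_mul_comm g (Y ω * Y ω), ← mul_assoc y (Ψ (Y ω + w)),
        rtr_mul_comm (y * Ψ (Y ω + w)), rtr_mul_comm (y * g), mul_assoc g,
        rtr_mul_comm g (y * Y ω)]
      simp only [← rtr_sub, ← rtr_add]
      congr 1; noncomm_ring
    rw [← r1, ← r2]
    exact pw ω
  have j2 : HasMean P (fun ω => rtr (Y ω * Y ω * EΨ)) (rtr (EΨ * M)) := by
    simpa only [rtr_mul_comm EΨ] using (hY.mul hY).hasMean_rtr_mul (P := P) EΨ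
  have j3 : HasMean P (fun ω => rtr (Ψ (Y ω + w) * M)) (rtr (EΨ * M)) := by
    simpa only [rtr_mul_comm M] using bΨ.hasMean_rtr_mul (P := P) M
  have fin := ((((HasMean.const a).sub (HasMean.const 0)).sub (hzero' EΦ)).add ha).mono
    (((((((((HasMean.const b).sub (hzero' E2)).sub (hzero' E1)).add j2).add j3).sub
      (HasMean.const 0)).sub (HasMean.const 0)).add hb).const_mul (1 / 2)) key
  have f3 : HasMean P (fun ω => rtr ((Y ω * Y ω + M) * Ψ (Y ω + w))) (b + rtr (EΨ * M)) := by
    simpa only [add_mul, rtr_add, rtr_mul_comm _ M] using hb.add j3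
  rw [f3.2]
  linarith

end RandomMatrices

/-! ### Sums of independent matrices and the maximal inequality -/

section SumsOfRandomMatrices

open Matrix

variable {𝕜 F : Type*} [RCLike 𝕜]
variable {Ω : Type*} [MeasurableSpace Ω] {P : Measure Ω}

lemma matExp_sum_eq_zero [IsProbabilityMeasure P] {κ : Type*} {Y : κ → Ω → Matrix F F 𝕜} (hY : ∀ i, IsBounded (Y i))
    (hY0 : ∀ i, matExp P (Y i) = 0) (s : Finset κ) :
    matExp P (fun ω => ∑ i ∈ s, Y i ω) = 0 := by
  ext a b
  simp only [matExp, Matrix.of_apply, Matrix.sum_apply, Matrix.zero_apply]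
  rw [integral_finsetSum _ fun i _ =>
    (hY i).integrable_comp (f := fun M => M a b) (continuous_id.matrix_elem a b)]
  refine Finset.sum_eq_zero fun i _ => ?_
  have := congrFun (congrFun (hY0 i) a) b
  simpa [matExp] using this

variable [Fintype F]

lemma indepFun_sum_erase {κ : Type*} [Fintype κ] [DecidableEq κ] {Y : κ → Ω → Matrix F F 𝕜}
    (hY : ∀ i, IsBounded (Y i)) (hind : iIndepFun Y P) (i : κ) :
    IndepFun (Y i) (fun ω => ∑ j ∈ Finset.univ.erase i, Y j ω) P := by
  have := (hind.indepFun_finsetSum_of_notMem (fun j => (hY j).1)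
    (Finset.notMem_erase i Finset.univ)).symm
  convert this using 1
  ext ω : 1
  simp

variable [IsProbabilityMeasure P]

lemma rtr_sum {κ : Type*} (s : Finset κ) (M : κ → Matrix F F 𝕜) :
    rtr (∑ i ∈ s, M i) = ∑ i ∈ s, rtr (M i) := by
  simp [rtr, Matrix.trace_sum]

lemma rtr_smul (c : ℝ) (M : Matrix F F 𝕜) : rtr ((c : 𝕜) • M) = c * rtr M := by
  rw [rtr, Matrix.trace_smul, smul_eq_mul, RCLike.re_ofReal_mul, rtr]

lemma integral_rtr_mul_eq_zero {Z D : Ω → Matrix F F 𝕜} (hZ : IsBounded Z) (hD : IsBounded D)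
    (h : IndepFun D Z P) (hD0 : matExp P D = 0) : ∫ ω, rtr (Z ω * D ω) ∂P = 0 := by
  have := (integral_eq_of_indepFun hD hZ h (f := fun p => rtr (p.2 * p.1))
    (continuous_rtr.comp (continuous_snd.mul continuous_fst))).1
  simp only [integral_rtr_mul hD, hD0, mul_zero] at this
  rw [this]
  simp [rtr]

variable [DecidableEq F]

/-- The exchangeable pair estimate for a sum of independent random matrices. -/
lemma integral_rtr_sum_mul_le {φ ψ : ℝ → ℝ} {Φ Ψ : Matrix F F 𝕜 → Matrix F F 𝕜}
    (hΦ : IsMatrixFun φ Φ) (hΨ : IsMatrixFun ψ Ψ)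
    (hφψ : ∀ a b, (a - b) * (φ a - φ b) ≤ 1 / 2 * ((a - b) ^ 2 * (ψ a + ψ b)))
    (hψ : ∀ x, 0 ≤ ψ x)
    {κ : Type*} [Fintype κ] {Y : κ → Ω → Matrix F F 𝕜} (hY : ∀ i, IsBounded (Y i))
    (hYH : ∀ i ω, (Y i ω).IsHermitian) (hY0 : ∀ i, matExp P (Y i) = 0) (hind : iIndepFun Y P)
    {V : Matrix F F 𝕜}
    (hV : ∀ ω, (V - ((1 / 2 : ℝ) : 𝕜) •
      ∑ i, (Y i ω * Y i ω + matExp P (fun ω => Y i ω * Y i ω))).PosSemidef) :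
    ∫ ω, rtr ((∑ i, Y i ω) * Φ (∑ i, Y i ω)) ∂P ≤ ∫ ω, rtr (V * Ψ (∑ i, Y i ω)) ∂P := by
  classical
  have hS : IsBounded fun ω => ∑ i, Y i ω := IsBounded.sum _ hY
  set M : κ → Matrix F F 𝕜 := fun i => matExp P (fun ω => Y i ω * Y i ω) with hM
  have hYM : ∀ i, IsBounded fun ω => Y i ω * Y i ω + M i := fun i =>
    ((hY i).mul (hY i)).add (IsBounded.const _)
  have hsum : ∀ ω i, Y i ω + ∑ j ∈ Finset.univ.erase i, Y j ω = ∑ j, Y j ω := fun ω i =>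
    Finset.add_sum_erase _ (fun j => Y j ω) (Finset.mem_univ i)
  -- By independence the sum of the other summands can be frozen; it plays the role of w in the
  -- one-summand estimate.
  have step : ∀ i, ∫ ω, rtr (Y i ω * Φ (∑ j, Y j ω)) ∂P ≤
      1 / 2 * ∫ ω, rtr ((Y i ω * Y i ω + M i) * Ψ (∑ j, Y j ω)) ∂P := by
    intro i
    have hW : IsBounded fun ω => ∑ j ∈ Finset.univ.erase i, Y j ω := IsBounded.sum _ hY
    have hi := indepFun_sum_erase hY hind i
    have h1 := integral_eq_of_indepFun (hY i) hW hi
      (f := fun p => rtr (p.1 * Φ (p.1 + p.2))) (continuous_rtr.comp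
        (continuous_fst.mul (hΦ.continuous.comp (continuous_fst.add continuous_snd))))
    have h2 := integral_eq_of_indepFun (hY i) hW hi
      (f := fun p => rtr ((p.1 * p.1 + M i) * Ψ (p.1 + p.2))) (continuous_rtr.comp
        (((continuous_fst.mul continuous_fst).add continuous_const).mul
          (hΨ.continuous.comp (continuous_fst.add continuous_snd))))
    simp only [hsum] at h1 h2
    rw [h1.1, h2.1, ← integral_const_mul]
    refine integral_mono h1.2 (h2.2.const_mul _) fun ω' => ?_
    exact integral_rtr_mul_le hΦ hΨ hφψ (hY i) (hYH i) (hY0 i)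
      (isSelfAdjoint_sum _ fun j _ => hYH j ω')
  have hΦS := hS.comp hΦ.continuous
  have hΨS := hS.comp hΨ.continuous
  calc ∫ ω, rtr ((∑ i, Y i ω) * Φ (∑ i, Y i ω)) ∂P
      = ∑ i, ∫ ω, rtr (Y i ω * Φ (∑ j, Y j ω)) ∂P := by
        rw [← integral_finsetSum _ fun i _ => ((hY i).mul hΦS).integrable_rtr]
        simp_rw [Finset.sum_mul, rtr_sum]
    _ ≤ ∑ i, 1 / 2 * ∫ ω, rtr ((Y i ω * Y i ω + M i) * Ψ (∑ j, Y j ω)) ∂P :=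
        Finset.sum_le_sum fun i _ => step i
    _ = ∫ ω, 1 / 2 * rtr ((∑ i, (Y i ω * Y i ω + M i)) * Ψ (∑ j, Y j ω)) ∂P := by
        rw [integral_const_mul, ← Finset.mul_sum,
          ← integral_finsetSum _ fun i _ => ((hYM i).mul hΨS).integrable_rtr]
        simp_rw [Finset.sum_mul, rtr_sum]
    _ ≤ _ := by
        refine integral_mono (((IsBounded.sum _ hYM).mul hΨS).integrable_rtr.const_mul _)
          ((IsBounded.const V).mul hΨS).integrable_rtr fun ω => ?_
        have hH : (∑ i, Y i ω).IsHermitian := isSelfAdjoint_sum _ fun j _ => hYH j ω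
        have := hΨ.rtr_mul_nonneg hψ hH (hV ω)
        rw [sub_mul, rtr_sub, Matrix.smul_mul, rtr_smul] at this
        exact sub_nonneg.1 this

/-- The maximal inequality for traces of convex functions of partial sums. -/
lemma mul_measureReal_exists_le {φ ψ : ℝ → ℝ} {Φ Ψ : Matrix F F 𝕜 → Matrix F F 𝕜}
    (hΦ : IsMatrixFun φ Φ) (hΨ : IsMatrixFun ψ Ψ) (hφ : ∀ x, 0 ≤ φ x)
    (hφψ : ∀ a b, φ a + ψ a * (b - a) ≤ φ b) {n : ℕ}
    {Y : Fin n → Ω → Matrix F F 𝕜} (hY : ∀ i, IsBounded (Y i))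
    (hYH : ∀ i ω, (Y i ω).IsHermitian) (hY0 : ∀ i, matExp P (Y i) = 0) (hind : iIndepFun Y P)
    (c : ℝ) :
    c * P.real {ω | ∃ k, c ≤ rtr (Φ (∑ j ∈ Finset.Iic k, Y j ω))} ≤
      ∫ ω, rtr (Φ (∑ j, Y j ω)) ∂P := by
  classical
  set S : Fin n → Ω → Matrix F F 𝕜 := fun k ω => ∑ j ∈ Finset.Iic k, Y j ω with hSdef
  set D : Fin n → Ω → Matrix F F 𝕜 := fun k ω => ∑ j ∈ Finset.Ioi k, Y j ω with hDdef
  have hT : IsBounded fun ω => ∑ i, Y i ω := IsBounded.sum _ hY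
  have hS : ∀ k, IsBounded (S k) := fun k => IsBounded.sum _ hY
  have hD : ∀ k, IsBounded (D k) := fun k => IsBounded.sum _ hY
  have hSD : ∀ k ω, ∑ j, Y j ω = S k ω + D k ω := fun k ω => by
    rw [hSdef, hDdef, ← Finset.sum_union]
    · congr 1; ext j; simp [le_or_gt]
    · exact Finset.disjoint_left.2 fun j hj hj' =>
        absurd (Finset.mem_Iic.1 hj) (not_le.2 (Finset.mem_Ioi.1 hj'))
  set f : Fin n → Ω → ℝ := fun k ω => rtr (Φ (S k ω)) with hf
  set m : Fin n → MeasurableSpace Ω := fun i => MeasurableSpace.comap (Y i) inferInstance with hm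
  -- First passage: `A k` is the event that k is the first index at which the trace reaches c.
  set A : Fin n → Set Ω := fun k => {ω | c ≤ f k ω} ∩ ⋂ j ∈ Set.Iio k, {ω | f j ω < c} with hA
  have hm_le : ∀ i, m i ≤ ‹MeasurableSpace Ω› := fun i => (hY i).1.comap_le
  have mY : ∀ (s : Set (Fin n)) (t : Finset (Fin n)), (∀ j ∈ t, j ∈ s) →
      Measurable[⨆ i ∈ s, m i] fun ω => ∑ j ∈ t, Y j ω := fun s t hst => by
    refine Finset.measurable_fun_sum _ fun j hj => ?_
    rw [measurable_iff_comap_le]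
    exact le_iSup₂_of_le j (hst j hj) le_rfl
  have mf : ∀ k j, j ≤ k → Measurable[⨆ i ∈ Set.Iic k, m i] (f j) := fun k j hjk =>
    (continuous_rtr.comp hΦ.continuous).measurable.comp
      (mY _ _ fun i hi => (Finset.mem_Iic.1 hi).trans hjk)
  have mA : ∀ k, MeasurableSet[⨆ i ∈ Set.Iic k, m i] (A k) := fun k => by
    refine MeasurableSet.inter ?_ (MeasurableSet.biInter (Set.to_countable _) fun j hj => ?_)
    · exact (mf k k le_rfl) measurableSet_Ici
    · exact (mf k j (le_of_lt hj)) measurableSet_Iio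
  have mA' : ∀ k, MeasurableSet (A k) := fun k =>
    (iSup₂_le fun i _ => hm_le i : (⨆ i ∈ Set.Iic k, m i) ≤ _) _ (mA k)
  have hdisj : Pairwise (Function.onFun Disjoint A) := by
    have : ∀ j k, j < k → Disjoint (A j) (A k) := fun j k hjk =>
      Set.disjoint_left.2 fun ω hj hk =>
        by
        have h1 : c ≤ f j ω := hj.1
        have h2 : f j ω < c := Set.mem_iInter₂.1 hk.2 j hjk
        exact h2.not_ge h1
    intro j k hjk
    rcases lt_or_gt_of_ne hjk with h | h
    · exact this j k h
    · exact (this k j h).symm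
  have hU : {ω | ∃ k, c ≤ f k ω} = ⋃ k, A k := by
    ext ω
    simp only [Set.mem_ofPred_eq, Set.mem_iUnion]
    constructor
    · rintro ⟨k, hk⟩
      obtain ⟨k₀, hk₀, hmin⟩ := WellFounded.has_min (wellFounded_lt (α := Fin n))
        {k | c ≤ f k ω} ⟨k, hk⟩
      exact ⟨k₀, hk₀, Set.mem_iInter₂.2 fun j hj =>
        (not_le.1 fun h => hmin j h hj : f j ω < c)⟩
    · rintro ⟨k, hk⟩
      exact ⟨k, hk.1⟩
  have fint : ∀ k, Integrable (f k) P := fun k => ((hS k).comp hΦ.continuous).integrable_rtr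
  have gint : Integrable (fun ω => rtr (Φ (∑ j, Y j ω))) P :=
    (hT.comp hΦ.continuous).integrable_rtr
  have hSH : ∀ k ω, (S k ω).IsHermitian := fun k ω => isSelfAdjoint_sum _ fun j _ => hYH j ω
  have hTH : ∀ ω, (∑ j, Y j ω).IsHermitian := fun ω => isSelfAdjoint_sum _ fun j _ => hYH j ω
  -- Submartingale step: Klein's inequality bounds tr Φ(S k) + tr Ψ(S k) D k by the trace at the
  -- full sum. The linear term has zero integral over `A k`, since the indicator of `A k` times Ψ(S
  -- k) depends only on the past while `D k` is centered and depends only on the future.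
  have hk : ∀ k, c * P.real (A k) ≤ ∫ ω in A k, rtr (Φ (∑ j, Y j ω)) ∂P := by
    intro k
    have bZ : IsBounded ((A k).indicator fun ω => Ψ (S k ω)) :=
      ((hS k).comp hΨ.continuous).indicator (mA' k)
    have hind' : IndepFun (D k) ((A k).indicator fun ω => Ψ (S k ω)) P := by
      have h0 := indep_iSup_of_disjoint (m := m) hm_le hind
        (Set.disjoint_left.2 fun j hj hj' => absurd (Set.mem_Iic.1 hj) (not_le.2 hj') :
          Disjoint (Set.Iic k) (Set.Ioi k))
      refine IndepFun.symm ?_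
      refine indep_of_indep_of_le_left (indep_of_indep_of_le_right h0 ?_) ?_
      · exact (mY _ _ fun i hi => Finset.mem_Ioi.1 hi).comap_le
      · refine Measurable.comap_le (Measurable.indicator ?_ (mA k))
        exact hΨ.continuous.measurable.comp (mY _ _ fun i hi => Finset.mem_Iic.1 hi)
    have hzero := integral_rtr_mul_eq_zero bZ (hD k) hind' (matExp_sum_eq_zero hY hY0 _)
    have hzero' : ∫ ω in A k, rtr (Ψ (S k ω) * D k ω) ∂P = 0 := by
      rw [← hzero, ← integral_indicator (mA' k)]
      congr 1; ext ω
      by_cases hω : ω ∈ A k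
      · simp [hω]
      · simp [hω, rtr]
    have pint : Integrable (fun ω => rtr (Ψ (S k ω) * D k ω)) P :=
      (((hS k).comp hΨ.continuous).mul (hD k)).integrable_rtr
    calc c * P.real (A k) = ∫ _ in A k, c ∂P := by
          rw [setIntegral_const, smul_eq_mul, mul_comm]
      _ ≤ ∫ ω in A k, f k ω ∂P :=
          setIntegral_mono_on (integrable_const _).integrableOn (fint k).integrableOn (mA' k)
            fun ω hω => hω.1
      _ = ∫ ω in A k, (f k ω + rtr (Ψ (S k ω) * D k ω)) ∂P := by
          rw [integral_add (fint k).integrableOn pint.integrableOn, hzero', add_zero]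
      _ ≤ _ := by
          refine setIntegral_mono ((fint k).add pint).integrableOn gint.integrableOn fun ω => ?_
          have := rtr_klein hΦ hΨ hφψ (hSH k ω) (hTH ω)
          rwa [show ∑ j, Y j ω - S k ω = D k ω by rw [hSD k ω]; abel] at this
  calc c * P.real {ω | ∃ k, c ≤ f k ω} = ∑ k, c * P.real (A k) := by
        rw [hU, measureReal_iUnion_fintype hdisj mA', Finset.mul_sum]
    _ ≤ ∑ k, ∫ ω in A k, rtr (Φ (∑ j, Y j ω)) ∂P := Finset.sum_le_sum fun k _ => hk k
    _ = ∫ ω in ⋃ k, A k, rtr (Φ (∑ j, Y j ω)) ∂P :=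
        (integral_iUnion_fintype mA' hdisj fun k => gint.integrableOn).symm
    _ ≤ _ := by
        refine setIntegral_le_integral gint (Filter.Eventually.of_forall fun ω => ?_)
        change 0 ≤ rtr (Φ (∑ j, Y j ω))
        rw [hΦ.rtr_eq (hTH ω)]
        exact Finset.sum_nonneg fun i _ => hφ _

end SumsOfRandomMatrices

/-! ### Scalar mean value inequality for the exponential -/

lemma sub_mul_exp_sub_exp_le (x y : ℝ) :
    (x - y) * (Real.exp x - Real.exp y) ≤
      1 / 2 * ((x - y) ^ 2 * (Real.exp x + Real.exp y)) := by
  -- Trapezoid bound for the integral of the convex function exp over [0, d]. The difference g of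
  -- the two sides has derivative ½(1 - (1 - t)eᵗ), nonnegative because 1 - t ≤ exp(-t).
  have base : ∀ d : ℝ, 0 ≤ d → Real.exp d - 1 ≤ d / 2 * (Real.exp d + 1) := by
    intro d hd
    set g : ℝ → ℝ := fun t => t / 2 * (Real.exp t + 1) - (Real.exp t - 1) with hg
    have hder : ∀ t, HasDerivAt g (1 / 2 * (Real.exp t + 1) + t / 2 * Real.exp t - Real.exp t) t := by
      intro t
      exact (((hasDerivAt_id t).div_const 2).mul ((Real.hasDerivAt_exp t).add_const 1)).sub
        ((Real.hasDerivAt_exp t).sub_const 1)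
    have hmono : Monotone g := monotone_of_deriv_nonneg (fun t => (hder t).differentiableAt) fun t => by
      rw [(hder t).deriv]
      have h1 := Real.add_one_le_exp (-t)
      have h2 : Real.exp (-t) * Real.exp t = 1 := by rw [← Real.exp_add]; simp
      have := mul_le_mul_of_nonneg_right h1 (Real.exp_pos t).le
      linarith
    have := hmono hd
    simp only [hg, zero_div, zero_mul, Real.exp_zero, sub_self] at this
    linarith
  have main : ∀ x y : ℝ, y ≤ x → (x - y) * (Real.exp x - Real.exp y) ≤
      1 / 2 * ((x - y) ^ 2 * (Real.exp x + Real.exp y)) := by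
    intro x y h
    have h1 := base (x - y) (sub_nonneg.2 h)
    have h2 : Real.exp x = Real.exp (x - y) * Real.exp y := by rw [← Real.exp_add]; simp
    have h3 := mul_le_mul_of_nonneg_left h1 (mul_nonneg (sub_nonneg.2 h) (Real.exp_pos y).le)
    rw [h2]
    linarith
  rcases le_total y x with h | h
  · exact main x y h
  · have := main y x h
    linarith

lemma sub_mul_exp_sub_exp_le_scaled {θ : ℝ} (hθ : 0 ≤ θ) (a b : ℝ) :
    (a - b) * ((Real.exp (θ * a) - 1) - (Real.exp (θ * b) - 1)) ≤
      1 / 2 * ((a - b) ^ 2 * (θ * Real.exp (θ * a) + θ * Real.exp (θ * b))) := by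
  rcases hθ.eq_or_lt with rfl | hθ
  · simp
  · have := sub_mul_exp_sub_exp_le (θ * a) (θ * b)
    refine le_of_mul_le_mul_left ?_ hθ
    linarith

/-! ### Exponential trace moments and finite-dimensional tail bounds -/

section ExponentialMoment

open Matrix

variable {𝕜 F : Type*} [RCLike 𝕜] [Fintype F] [DecidableEq F]
variable {Ω : Type*} [MeasurableSpace Ω] {P : Measure Ω} [IsProbabilityMeasure P]

/-- The matrix `exp (θ A) - 1 - θ A`. -/
noncomputable def expRem (θ : ℝ) (A : Matrix F F 𝕜) : Matrix F F 𝕜 :=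
  NormedSpace.exp ((θ : 𝕜) • A) - 1 - (θ : 𝕜) • A

lemma isMatrixFun_expRem (θ : ℝ) :
    IsMatrixFun (fun x => Real.exp (θ * x) - 1 - θ * x)
      (expRem θ : Matrix F F 𝕜 → Matrix F F 𝕜) :=
  ((isMatrixFun_exp θ).sub isMatrixFun_one).sub (isMatrixFun_id.const_smul θ)

lemma isMatrixFun_exp_sub_one (θ : ℝ) :
    IsMatrixFun (fun x => Real.exp (θ * x) - 1)
      (fun A : Matrix F F 𝕜 => NormedSpace.exp ((θ : 𝕜) • A) - 1) :=
  (isMatrixFun_exp θ).sub isMatrixFun_one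

lemma expRem_neg (θ : ℝ) (A : Matrix F F 𝕜) : expRem θ (-A) = expRem (-θ) A := by
  simp [expRem]

lemma exp_sub_one_sub_nonneg (x : ℝ) : 0 ≤ Real.exp x - 1 - x := by
  linarith [Real.add_one_le_exp x]

lemma hasDerivAt_rtr_expRem {A : Matrix F F 𝕜} (hA : A.IsHermitian) (θ : ℝ) :
    HasDerivAt (fun θ => rtr (expRem θ A))
      (rtr (A * (NormedSpace.exp ((θ : 𝕜) • A) - 1))) θ := by
  have h1 : (fun θ => rtr (expRem θ A)) = fun θ => ∑ i, (Real.exp (θ * hA.eigenvalues i) - 1 -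
      θ * hA.eigenvalues i) := by
    ext θ; exact (isMatrixFun_expRem θ).rtr_eq hA
  rw [h1, (isMatrixFun_id.mul (isMatrixFun_exp_sub_one θ)).rtr_eq hA]
  refine HasDerivAt.fun_sum fun i _ => ?_
  have h2 : HasDerivAt (fun t => t * hA.eigenvalues i) (hA.eigenvalues i) θ := by
    simpa using (hasDerivAt_id θ).mul_const (hA.eigenvalues i)
  exact ((h2.exp.sub_const 1).sub h2).congr_deriv (by ring)

lemma hasDerivAt_integral_rtr_expRem {S : Ω → Matrix F F 𝕜} (hS : IsBounded S)
    (hSH : ∀ ω, (S ω).IsHermitian) (θ : ℝ) :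
    HasDerivAt (fun θ => ∫ ω, rtr (expRem θ (S ω)) ∂P)
      (∫ ω, rtr (S ω * (NormedSpace.exp ((θ : 𝕜) • S ω) - 1)) ∂P) θ := by
  obtain ⟨-, K, hK, hSK⟩ := id hS
  have hexp : Continuous fun p : ℝ × Matrix F F 𝕜 => NormedSpace.exp ((p.1 : 𝕜) • p.2) :=
    continuous_exp_matrix.comp
      ((RCLike.continuous_ofReal.comp continuous_fst).fun_smul continuous_snd)
  have hcont : Continuous fun p : ℝ × Matrix F F 𝕜 =>
      rtr (p.2 * (NormedSpace.exp ((p.1 : 𝕜) • p.2) - 1)) :=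
    continuous_rtr.comp (continuous_snd.mul (hexp.sub (continuous_const (y := 1))))
  -- The derivative is jointly continuous in parameter and matrix, hence bounded on a compact
  -- product; this constant dominates it for differentiation under the integral.
  obtain ⟨C, hC⟩ := ((isCompact_closedBall θ 1).prod hK).exists_bound_of_continuousOn
    hcont.continuousOn
  exact (hasDerivAt_integral_of_dominated_loc_of_deriv_le (bound := fun _ => C)
    (Metric.closedBall_mem_nhds θ one_pos)
    (Filter.Eventually.of_forall fun t =>
      ((hS.comp (isMatrixFun_expRem t).continuous).integrable_rtr).aestronglyMeasurable)
    ((hS.comp (isMatrixFun_expRem θ).continuous).integrable_rtr)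
    ((hS.mul (hS.comp (isMatrixFun_exp_sub_one θ).continuous)).integrable_rtr).aestronglyMeasurable
    (Filter.Eventually.of_forall fun ω t ht => hC (t, S ω) ⟨ht, hSK ω⟩)
    (integrable_const C)
    (Filter.Eventually.of_forall fun ω t _ => hasDerivAt_rtr_expRem (hSH ω) t)).2

/-- The bound on the exponential trace moment of a sum of independent random matrices. -/
lemma integral_rtr_expRem_le_of_nonneg {κ : Type*} [Fintype κ] {Y : κ → Ω → Matrix F F 𝕜}
    (hY : ∀ i, IsBounded (Y i)) (hYH : ∀ i ω, (Y i ω).IsHermitian)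
    (hY0 : ∀ i, matExp P (Y i) = 0) (hind : iIndepFun Y P) {V : Matrix F F 𝕜}
    (hV : ∀ ω, (V - ((1 / 2 : ℝ) : 𝕜) •
      ∑ i, (Y i ω * Y i ω + matExp P (fun ω => Y i ω * Y i ω))).PosSemidef)
    {σ τ : ℝ} (hVσ : (((σ ^ 2 : ℝ) : 𝕜) • (1 : Matrix F F 𝕜) - V).PosSemidef)
    (hVτ : rtr V ≤ τ * σ ^ 2) {θ : ℝ} (hθ : 0 ≤ θ) :
    ∫ ω, rtr (expRem θ (∑ i, Y i ω)) ∂P ≤ τ * (Real.exp (θ ^ 2 * σ ^ 2 / 2) - 1) := by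
  set S : Ω → Matrix F F 𝕜 := fun ω => ∑ i, Y i ω with hSdef
  have hS : IsBounded S := IsBounded.sum _ hY
  have hSH : ∀ ω, (S ω).IsHermitian := fun ω => isSelfAdjoint_sum _ fun j _ => hYH j ω
  set f : ℝ → ℝ := fun θ => ∫ ω, rtr (expRem θ (S ω)) ∂P with hf
  set f' : ℝ → ℝ := fun θ => ∫ ω, rtr (S ω * (NormedSpace.exp ((θ : 𝕜) • S ω) - 1)) ∂P with hf'
  have hder : ∀ θ, HasDerivAt f (f' θ) θ := hasDerivAt_integral_rtr_expRem hS hSH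
  -- The differential inequality. In V exp(θS) = V expRem + V + θVS the last term has mean trace
  -- zero, and the first is controlled by V ≼ σ² because the remainder is positive semidefinite.
  have hle : ∀ θ, 0 ≤ θ → f' θ ≤ θ * σ ^ 2 * (f θ + τ) := by
    intro θ hθ
    have h1 := integral_rtr_sum_mul_le (P := P) (isMatrixFun_exp_sub_one (𝕜 := 𝕜) (F := F) θ)
      ((isMatrixFun_exp (𝕜 := 𝕜) (F := F) θ).const_smul θ) (sub_mul_exp_sub_exp_le_scaled hθ)
      (fun x => mul_nonneg hθ (Real.exp_pos _).le) hY hYH hY0 hind hV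
    have hR : IsBounded fun ω => expRem θ (S ω) := hS.comp (isMatrixFun_expRem θ).continuous
    have m1 : HasMean P (fun ω => θ * (rtr (V * expRem θ (S ω)) + rtr V + θ * rtr (V * S ω)))
        (θ * (∫ ω, rtr (V * expRem θ (S ω)) ∂P + rtr V + θ * 0)) := by
      refine HasMean.const_mul (((((IsBounded.const V).mul hR).hasMean_rtr).add
        (HasMean.const _)).add (HasMean.const_mul ?_ θ)) θ
      have := hS.hasMean_rtr_mul (P := P) V
      rwa [matExp_sum_eq_zero hY hY0, mul_zero, show rtr (0 : Matrix F F 𝕜) = 0 by simp [rtr]]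
        at this
    have h2 : ∫ ω, rtr (V * ((θ : 𝕜) • NormedSpace.exp ((θ : 𝕜) • S ω))) ∂P =
        θ * (∫ ω, rtr (V * expRem θ (S ω)) ∂P + rtr V) := by
      rw [mul_zero, add_zero] at m1
      rw [← m1.2]
      congr 1; ext ω
      beta_reduce
      rw [Matrix.mul_smul, rtr_smul, ← rtr_smul θ (V * S ω), ← Matrix.mul_smul, ← rtr_add,
        ← rtr_add]
      congr 2
      rw [expRem]
      noncomm_ring
    have h3 : ∫ ω, rtr (V * expRem θ (S ω)) ∂P ≤ σ ^ 2 * f θ := by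
      rw [hf, ← integral_const_mul]
      refine integral_mono ((IsBounded.const V).mul hR).integrable_rtr
        (hR.integrable_rtr.const_mul _) fun ω => ?_
      have := (isMatrixFun_expRem (𝕜 := 𝕜) (F := F) θ).rtr_mul_nonneg
        (fun x => exp_sub_one_sub_nonneg _) (hSH ω) hVσ
      rw [sub_mul, rtr_sub, Matrix.smul_mul, rtr_smul, one_mul] at this
      exact sub_nonneg.1 this
    calc f' θ ≤ θ * (∫ ω, rtr (V * expRem θ (S ω)) ∂P + rtr V) := h1.trans h2.le
      _ ≤ θ * (σ ^ 2 * f θ + τ * σ ^ 2) := by gcongr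
      _ = _ := by ring
  -- Grönwall's integrating factor: `g` is antitone on [0, ∞) and equals τ at 0.
  set g : ℝ → ℝ := fun θ => (f θ + τ) * Real.exp (-(θ ^ 2 * σ ^ 2 / 2)) with hg
  have hgder : ∀ θ, HasDerivAt g (f' θ * Real.exp (-(θ ^ 2 * σ ^ 2 / 2)) +
      (f θ + τ) * (Real.exp (-(θ ^ 2 * σ ^ 2 / 2)) * (-(θ * σ ^ 2)))) θ := by
    intro θ
    refine ((hder θ).add_const τ).mul (HasDerivAt.exp ?_)
    have := (((hasDerivAt_pow 2 θ).mul_const (σ ^ 2)).div_const 2).neg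
    exact this.congr_deriv (by norm_num; ring)
  have hanti : AntitoneOn g (Set.Ici 0) := by
    refine antitoneOn_of_deriv_nonpos (convex_Ici 0)
      (fun t _ => (hgder t).continuousAt.continuousWithinAt)
      (fun t _ => (hgder t).differentiableAt.differentiableWithinAt) fun t ht => ?_
    rw [interior_Ici] at ht
    rw [(hgder t).deriv]
    have := mul_le_mul_of_nonneg_right (hle t (le_of_lt ht))
      (Real.exp_pos (-(t ^ 2 * σ ^ 2 / 2))).le
    linarith
  have h0 : f 0 = 0 := by simp [hf, expRem, rtr]
  have hfin := hanti Set.self_mem_Ici hθ hθ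
  simp only [hg, h0] at hfin
  rw [Real.exp_neg, ← div_eq_mul_inv, div_le_iff₀ (Real.exp_pos _)] at hfin
  simp only [ne_eq, OfNat.ofNat_ne_zero, not_false_eq_true, zero_pow, zero_mul, zero_div, neg_zero,
    Real.exp_zero, mul_one, zero_add] at hfin
  linarith

/-- Negative θ reduces to positive θ by replacing Y with -Y: the condition on V involves only
squares, so the same V serves. -/
lemma integral_rtr_expRem_le {κ : Type*} [Fintype κ] {Y : κ → Ω → Matrix F F 𝕜}
    (hY : ∀ i, IsBounded (Y i)) (hYH : ∀ i ω, (Y i ω).IsHermitian)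
    (hY0 : ∀ i, matExp P (Y i) = 0) (hind : iIndepFun Y P) {V : Matrix F F 𝕜}
    (hV : ∀ ω, (V - ((1 / 2 : ℝ) : 𝕜) •
      ∑ i, (Y i ω * Y i ω + matExp P (fun ω => Y i ω * Y i ω))).PosSemidef)
    {σ τ : ℝ} (hVσ : (((σ ^ 2 : ℝ) : 𝕜) • (1 : Matrix F F 𝕜) - V).PosSemidef)
    (hVτ : rtr V ≤ τ * σ ^ 2) (θ : ℝ) :
    ∫ ω, rtr (expRem θ (∑ i, Y i ω)) ∂P ≤ τ * (Real.exp (θ ^ 2 * σ ^ 2 / 2) - 1) := by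
  rcases le_total 0 θ with hθ | hθ
  · exact integral_rtr_expRem_le_of_nonneg hY hYH hY0 hind hV hVσ hVτ hθ
  · have := integral_rtr_expRem_le_of_nonneg (P := P) (Y := fun i ω => - Y i ω) (V := V)
      (fun i => (hY i).neg) (fun i ω => (hYH i ω).neg)
      (fun i => by
        ext a b
        have := congrFun (congrFun (hY0 i) a) b
        simpa [matExp, integral_neg] using this)
      (hind.comp (fun _ M => -M) fun _ => continuous_neg.measurable)
      (fun ω => by simpa only [neg_mul_neg] using hV ω) hVσ hVτ (neg_nonneg.2 hθ)
    simpa only [Finset.sum_neg_distrib, expRem_neg, neg_neg, neg_sq] using this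

/-- One-sided tail bound for the eigenvalues of partial sums, finite-dimensional case. -/
lemma measureReal_exists_eigenvalue_mul_le {n : ℕ} {Y : Fin n → Ω → Matrix F F 𝕜}
    (hY : ∀ i, IsBounded (Y i)) (hYH : ∀ i ω, (Y i ω).IsHermitian)
    (hY0 : ∀ i, matExp P (Y i) = 0) (hind : iIndepFun Y P) {V : Matrix F F 𝕜}
    (hV : ∀ ω, (V - ((1 / 2 : ℝ) : 𝕜) •
      ∑ i, (Y i ω * Y i ω + matExp P (fun ω => Y i ω * Y i ω))).PosSemidef)
    {σ τ : ℝ} (hVσ : (((σ ^ 2 : ℝ) : 𝕜) • (1 : Matrix F F 𝕜) - V).PosSemidef)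
    (hVτ : rtr V ≤ τ * σ ^ 2) {θ r : ℝ} (hθ : 0 ≤ θ) (hr : 0 ≤ r) :
    (Real.exp (θ * r) - 1 - θ * r) * P.real {ω | ∃ k, ∃ c : F → 𝕜,
      r * RCLike.re (star c ⬝ᵥ c) <
        RCLike.re (star c ⬝ᵥ ((∑ j ∈ Finset.Iic k, Y j ω) *ᵥ c))} ≤
      τ * (Real.exp (θ ^ 2 * σ ^ 2 / 2) - 1) := by
  have hmono : ∀ x, r ≤ x → Real.exp (θ * r) - 1 - θ * r ≤ Real.exp (θ * x) - 1 - θ * x := by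
    intro x hx
    have h1 := Real.add_one_le_exp (θ * x - θ * r)
    have h2 : Real.exp (θ * x) = Real.exp (θ * x - θ * r) * Real.exp (θ * r) := by
      rw [← Real.exp_add]; simp
    have h3 : 1 ≤ Real.exp (θ * r) := Real.one_le_exp (mul_nonneg hθ hr)
    have h4 : 0 ≤ θ * x - θ * r := by rw [← mul_sub]; exact mul_nonneg hθ (sub_nonneg.2 hx)
    rw [h2]
    nlinarith
  -- A single eigenvalue above r already forces the trace up to the level at r, since every
  -- eigenvalue contributes a nonnegative amount and the remainder is increasing on [r, ∞).
  refine le_trans (le_trans (mul_le_mul_of_nonneg_left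
    (measureReal_mono fun ω hω => ?_) (exp_sub_one_sub_nonneg _))
    (mul_measureReal_exists_le (P := P) (isMatrixFun_expRem (𝕜 := 𝕜) (F := F) θ)
      ((isMatrixFun_exp_sub_one (𝕜 := 𝕜) (F := F) θ).const_smul θ)
      (fun x => exp_sub_one_sub_nonneg _) (fun a b => ?_) hY hYH hY0 hind _))
    (integral_rtr_expRem_le hY hYH hY0 hind hV hVσ hVτ θ)
  · obtain ⟨k, c, hc⟩ := hω
    have hSH : (∑ j ∈ Finset.Iic k, Y j ω).IsHermitian := isSelfAdjoint_sum _ fun j _ => hYH j ω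
    obtain ⟨i, hi⟩ := exists_eigenvalue_gt hSH hc
    refine ⟨k, ?_⟩
    rw [(isMatrixFun_expRem θ).rtr_eq hSH]
    exact (hmono _ hi.le).trans (Finset.single_le_sum
      (f := fun i => Real.exp (θ * hSH.eigenvalues i) - 1 - θ * hSH.eigenvalues i)
      (fun i _ => exp_sub_one_sub_nonneg _) (Finset.mem_univ i))
  -- Tangent line inequality for the convex function exp(θx) - 1 - θx, as Klein's inequality
  -- requires.
  · have h1 := Real.add_one_le_exp (θ * b - θ * a)
    have h2 : Real.exp (θ * b) = Real.exp (θ * b - θ * a) * Real.exp (θ * a) := by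
      rw [← Real.exp_add]; simp
    have := mul_le_mul_of_nonneg_right h1 (Real.exp_pos (θ * a)).le
    rw [h2]
    linarith

/-- The matrix `cosh (θ A) - 1`. -/
noncomputable def coshRem (θ : ℝ) (A : Matrix F F 𝕜) : Matrix F F 𝕜 :=
  ((1 / 2 : ℝ) : 𝕜) • (expRem θ A + expRem (-θ) A)

lemma isMatrixFun_coshRem (θ : ℝ) :
    IsMatrixFun (fun x => Real.cosh (θ * x) - 1)
      (coshRem θ : Matrix F F 𝕜 → Matrix F F 𝕜) := by
  have h : (fun x => Real.cosh (θ * x) - 1) = fun x => 1 / 2 *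
      ((Real.exp (θ * x) - 1 - θ * x) + (Real.exp (-θ * x) - 1 - -θ * x)) := by
    ext x
    rw [Real.cosh_eq, neg_mul]
    ring
  rw [h]
  exact ((isMatrixFun_expRem θ).add (isMatrixFun_expRem (-θ))).const_smul (1 / 2)

/-- Two-sided tail bound for the eigenvalues of partial sums, finite-dimensional case. -/
lemma measureReal_exists_abs_eigenvalue_mul_le {n : ℕ} {Y : Fin n → Ω → Matrix F F 𝕜}
    (hY : ∀ i, IsBounded (Y i)) (hYH : ∀ i ω, (Y i ω).IsHermitian)
    (hY0 : ∀ i, matExp P (Y i) = 0) (hind : iIndepFun Y P) {V : Matrix F F 𝕜}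
    (hV : ∀ ω, (V - ((1 / 2 : ℝ) : 𝕜) •
      ∑ i, (Y i ω * Y i ω + matExp P (fun ω => Y i ω * Y i ω))).PosSemidef)
    {σ τ : ℝ} (hVσ : (((σ ^ 2 : ℝ) : 𝕜) • (1 : Matrix F F 𝕜) - V).PosSemidef)
    (hVτ : rtr V ≤ τ * σ ^ 2) (θ : ℝ) {r : ℝ} (hr : 0 ≤ r) :
    (Real.cosh (θ * r) - 1) * P.real {ω | ∃ k, ∃ c : F → 𝕜,
      r * RCLike.re (star c ⬝ᵥ c) <
        |RCLike.re (star c ⬝ᵥ ((∑ j ∈ Finset.Iic k, Y j ω) *ᵥ c))|} ≤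
      τ * (Real.exp (θ ^ 2 * σ ^ 2 / 2) - 1) := by
  have hnn : ∀ x : ℝ, 0 ≤ Real.cosh x - 1 := fun x => sub_nonneg.2 (Real.one_le_cosh x)
  have hmom : ∫ ω, rtr (coshRem θ (∑ j, Y j ω)) ∂P ≤ τ * (Real.exp (θ ^ 2 * σ ^ 2 / 2) - 1) := by
    have hS : IsBounded fun ω => ∑ j, Y j ω := IsBounded.sum _ hY
    have h1 := integral_rtr_expRem_le (P := P) hY hYH hY0 hind hV hVσ hVτ θ
    have h2 := integral_rtr_expRem_le (P := P) hY hYH hY0 hind hV hVσ hVτ (-θ)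
    simp only [coshRem, rtr_smul, rtr_add]
    rw [integral_const_mul, integral_add
      (hS.comp (isMatrixFun_expRem θ).continuous).integrable_rtr
      (hS.comp (isMatrixFun_expRem (-θ)).continuous).integrable_rtr]
    rw [neg_sq] at h2
    linarith
  have hmono : ∀ x, r ≤ |x| → Real.cosh (θ * r) - 1 ≤ Real.cosh (θ * x) - 1 := by
    intro x hx
    refine sub_le_sub_right (Real.cosh_le_cosh.2 ?_) _
    rw [abs_mul, abs_mul, abs_of_nonneg hr]
    gcongr
  have hquad : ∀ A : Matrix F F 𝕜, A.IsHermitian → ∀ c : F → 𝕜,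
      r * RCLike.re (star c ⬝ᵥ c) < RCLike.re (star c ⬝ᵥ (A *ᵥ c)) →
      Real.cosh (θ * r) - 1 ≤ rtr (coshRem θ A) := by
    intro A hA c hc
    obtain ⟨i, hi⟩ := exists_eigenvalue_gt hA hc
    rw [(isMatrixFun_coshRem θ).rtr_eq hA]
    exact (hmono _ (hi.le.trans (le_abs_self _))).trans (Finset.single_le_sum
      (f := fun i => Real.cosh (θ * hA.eigenvalues i) - 1) (fun i _ => hnn _) (Finset.mem_univ i))
  refine le_trans (le_trans (mul_le_mul_of_nonneg_left
    (measureReal_mono fun ω hω => ?_) (hnn _))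
    (mul_measureReal_exists_le (P := P) (isMatrixFun_coshRem (𝕜 := 𝕜) (F := F) θ)
      -- The derivative θ sinh(θx) of cosh(θx) - 1, written with exponentials.
      (((isMatrixFun_exp (𝕜 := 𝕜) (F := F) θ).sub (isMatrixFun_exp (-θ))).const_smul (θ / 2))
      (fun x => hnn _) (fun a b => ?_) hY hYH hY0 hind _)) hmom
  · obtain ⟨k, c, hc⟩ := hω
    have hSH : (∑ j ∈ Finset.Iic k, Y j ω).IsHermitian := isSelfAdjoint_sum _ fun j _ => hYH j ω
    refine ⟨k, ?_⟩
    rcases lt_abs.1 hc with h | h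
    · exact hquad _ hSH c h
    · have h' := hquad _ hSH.neg c (by rwa [Matrix.neg_mulVec, dotProduct_neg, map_neg])
      rwa [coshRem, expRem_neg, expRem_neg, neg_neg, add_comm] at h'
  · have h1 := Real.add_one_le_exp (θ * b - θ * a)
    have h2 : Real.exp (θ * b) = Real.exp (θ * b - θ * a) * Real.exp (θ * a) := by
      rw [← Real.exp_add]; simp
    have h3 := Real.add_one_le_exp (θ * a - θ * b)
    have h4 : Real.exp (-θ * b) = Real.exp (θ * a - θ * b) * Real.exp (-θ * a) := by
      rw [← Real.exp_add]; congr 1; ring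
    have h5 := mul_le_mul_of_nonneg_right h1 (Real.exp_pos (θ * a)).le
    have h6 := mul_le_mul_of_nonneg_right h3 (Real.exp_pos (-θ * a)).le
    rw [Real.cosh_eq, Real.cosh_eq, ← neg_mul, ← neg_mul, h2, h4]
    linarith

end ExponentialMoment

/-! ### Compression of operators to finite-dimensional subspaces -/

section Compression

open Matrix

variable {𝕜 H : Type*} [RCLike 𝕜] [NormedAddCommGroup H] [InnerProductSpace 𝕜 H]
variable {F : Type*}

/-- The matrix of the compression of an operator to the span of the vectors `v`. -/
noncomputable def compress (v : F → H) (T : H →L[𝕜] H) : Matrix F F 𝕜 :=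
  Matrix.of fun a b => inner 𝕜 (v a) (T (v b))

lemma continuous_compress (v : F → H) : Continuous (compress (𝕜 := 𝕜) v) := by
  refine continuous_pi fun a => continuous_pi fun b => ?_
  exact continuous_const.inner (ContinuousLinearMap.apply 𝕜 H (v b)).continuous

lemma compress_add (v : F → H) (S T : H →L[𝕜] H) :
    compress v (S + T) = compress v S + compress v T := by
  ext a b; simp [compress, inner_add_right]

lemma compress_sub (v : F → H) (S T : H →L[𝕜] H) :
    compress v (S - T) = compress v S - compress v T := by
  ext a b; simp [compress, inner_sub_right]

lemma compress_sum {κ : Type*} (v : F → H) (s : Finset κ) (T : κ → H →L[𝕜] H) :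
    compress v (∑ i ∈ s, T i) = ∑ i ∈ s, compress v (T i) := by
  ext a b
  simp [compress, inner_sum, Matrix.sum_apply]

lemma compress_smul (v : F → H) (c : 𝕜) (T : H →L[𝕜] H) :
    compress v (c • T) = c • compress v T := by
  ext a b; simp [compress, inner_smul_right]

lemma isHermitian_compress [CompleteSpace H] (v : F → H) {T : H →L[𝕜] H} (hT : IsSelfAdjoint T) :
    (compress v T).IsHermitian := by
  ext a b
  have := hT.isSymmetric (v a) (v b)
  simp only [ContinuousLinearMap.coe_coe] at this
  simp [compress, this]

variable [Fintype F]

lemma compress_mulVec (v : F → H) (T : H →L[𝕜] H) (c : F → 𝕜) (a : F) :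
    (compress v T *ᵥ c) a = inner 𝕜 (v a) (T (∑ b, c b • v b)) := by
  simp [compress, Matrix.mulVec, dotProduct, inner_sum, inner_smul_right, mul_comm]

lemma star_dotProduct_compress_mulVec (v : F → H) (T : H →L[𝕜] H) (c : F → 𝕜) :
    star c ⬝ᵥ (compress v T *ᵥ c) =
      inner 𝕜 (∑ b, c b • v b) (T (∑ b, c b • v b)) := by
  rw [sum_inner, dotProduct]
  refine Finset.sum_congr rfl fun a _ => ?_
  rw [compress_mulVec, inner_smul_left]
  rfl

lemma star_dotProduct_self {v : F → H} (hv : Orthonormal 𝕜 v) (c : F → 𝕜) :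
    star c ⬝ᵥ c = ((‖∑ b, c b • v b‖ ^ 2 : ℝ) : 𝕜) := by
  rw [RCLike.ofReal_pow, ← inner_self_eq_norm_sq_to_K (𝕜 := 𝕜), hv.inner_sum]
  rfl

lemma isHermitian_mul_self_of_isHermitian {M : Matrix F F 𝕜} (hM : M.IsHermitian) :
    (M * M).IsHermitian := by
  rw [IsHermitian, conjTranspose_mul, hM.eq]

lemma posSemidef_of_re {M : Matrix F F 𝕜} (hM : M.IsHermitian)
    (h : ∀ c : F → 𝕜, 0 ≤ RCLike.re (star c ⬝ᵥ (M *ᵥ c))) : M.PosSemidef :=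
  PosSemidef.of_dotProduct_mulVec_nonneg hM fun c =>
    RCLike.nonneg_iff.2 ⟨h c, hM.im_star_dotProduct_mulVec_self c⟩

lemma posSemidef_compress [CompleteSpace H] (v : F → H) {T : H →L[𝕜] H} (hT : T.IsPositive) :
    (compress v T).PosSemidef := by
  refine posSemidef_of_re (isHermitian_compress v hT.isSelfAdjoint) fun c => ?_
  rw [star_dotProduct_compress_mulVec]
  exact hT.re_inner_nonneg_right _

lemma inner_sq_apply [CompleteSpace H] {T : H →L[𝕜] H} (hT : IsSelfAdjoint T) (x : H) :
    inner 𝕜 x ((T ^ 2) x) = ((‖T x‖ ^ 2 : ℝ) : 𝕜) := by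
  have := hT.isSymmetric x (T x)
  simp only [ContinuousLinearMap.coe_coe] at this
  rw [sq, mul_apply_eq_comp, ← this, inner_self_eq_norm_sq_to_K, RCLike.ofReal_pow]

lemma isPositive_sq_of_isSelfAdjoint [CompleteSpace H] {T : H →L[𝕜] H} (hT : IsSelfAdjoint T) :
    (T ^ 2).IsPositive := by
  rw [ContinuousLinearMap.isPositive_def']
  refine ⟨hT.pow 2, fun x => ?_⟩
  rw [ContinuousLinearMap.reApplyInnerSelf_apply, inner_re_symm, inner_sq_apply hT,
    RCLike.ofReal_re]
  positivity

lemma norm_apply_le_of_sq_le_sq [CompleteSpace H] {S T : H →L[𝕜] H} (hS : IsSelfAdjoint S)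
    (hT : IsSelfAdjoint T) (h : S ^ 2 ≤ T ^ 2) (x : H) : ‖S x‖ ≤ ‖T x‖ := by
  rw [ContinuousLinearMap.le_def] at h
  have := h.re_inner_nonneg_right x
  rw [_root_.sub_apply, inner_sub_right, inner_sq_apply hS, inner_sq_apply hT, map_sub,
    RCLike.ofReal_re, RCLike.ofReal_re] at this
  exact le_of_sq_le_sq (sub_nonneg.1 this) (norm_nonneg _)

/-- Bessel's inequality: at x = ∑ c b • v b the quadratic form of the difference is ‖Tx‖² minus the
sum of the squared coefficients of Tx along `v`. -/
lemma posSemidef_compress_sq_sub [CompleteSpace H] {v : F → H} (hv : Orthonormal 𝕜 v)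
    {T : H →L[𝕜] H} (hT : IsSelfAdjoint T) :
    (compress v (T ^ 2) - compress v T * compress v T).PosSemidef := by
  have hH := isHermitian_compress v hT
  refine posSemidef_of_re ((isHermitian_compress v (hT.pow 2)).sub
    (isHermitian_mul_self_of_isHermitian hH)) fun c => ?_
  have h1 : star c ⬝ᵥ ((compress v T * compress v T) *ᵥ c) =
      ((∑ a, ‖inner 𝕜 (v a) (T (∑ b, c b • v b))‖ ^ 2 : ℝ) : 𝕜) := by
    rw [← Matrix.mulVec_mulVec, Matrix.dotProduct_mulVec]
    have : star c ᵥ* compress v T = star (compress v T *ᵥ c) := by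
      rw [Matrix.star_mulVec, hH.eq]
    rw [this, dotProduct]
    push_cast
    refine Finset.sum_congr rfl fun a _ => ?_
    rw [Pi.star_apply, RCLike.star_def, RCLike.conj_mul, compress_mulVec]
  rw [Matrix.sub_mulVec, dotProduct_sub, h1, star_dotProduct_compress_mulVec, inner_sq_apply hT,
    map_sub, RCLike.ofReal_re, RCLike.ofReal_re, sub_nonneg]
  exact hv.sum_inner_products_le _

/-- The compact set of Hermitian matrices whose square is dominated by `B`. -/
def sqLeSet (B : Matrix F F 𝕜) : Set (Matrix F F 𝕜) :=
  {M | M.IsHermitian ∧ ∀ c : F → 𝕜,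
    RCLike.re (star c ⬝ᵥ ((M * M) *ᵥ c)) ≤ RCLike.re (star c ⬝ᵥ (B *ᵥ c))}

lemma isClosed_sqLeSet (B : Matrix F F 𝕜) : IsClosed (sqLeSet B) := by
  have h1 : IsClosed {M : Matrix F F 𝕜 | M.IsHermitian} :=
    isClosed_eq continuous_id.matrix_conjTranspose continuous_id
  have h2 : IsClosed (⋂ c : F → 𝕜, {M : Matrix F F 𝕜 |
      RCLike.re (star c ⬝ᵥ ((M * M) *ᵥ c)) ≤ RCLike.re (star c ⬝ᵥ (B *ᵥ c))}) := by
    refine isClosed_iInter fun c => isClosed_le (RCLike.continuous_re.comp ?_) continuous_const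
    exact continuous_const.dotProduct
      ((continuous_id.mul continuous_id).matrix_mulVec continuous_const)
  have : sqLeSet B = {M : Matrix F F 𝕜 | M.IsHermitian} ∩ ⋂ c : F → 𝕜, {M : Matrix F F 𝕜 |
      RCLike.re (star c ⬝ᵥ ((M * M) *ᵥ c)) ≤ RCLike.re (star c ⬝ᵥ (B *ᵥ c))} := by
    ext M; simp [sqLeSet]
  rw [this]
  exact h1.inter h2

/-- For Hermitian M the diagonal entry (M²)_bb is the squared norm of column b, so every entry of
that column is at most the square root of B_bb in modulus. -/
lemma isCompact_sqLeSet (B : Matrix F F 𝕜) : IsCompact (sqLeSet B) := by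
  classical
  have hK : IsCompact (Set.pi Set.univ fun _ : F => Set.pi Set.univ fun b : F =>
      Metric.closedBall (0 : 𝕜) (Real.sqrt (RCLike.re (B b b)))) :=
    isCompact_univ_pi fun _ => isCompact_univ_pi fun _ => isCompact_closedBall _ _
  refine hK.of_isClosed_subset (isClosed_sqLeSet B) fun (M : Matrix F F 𝕜) hM => ?_
  refine Set.mem_univ_pi.2 fun a => Set.mem_univ_pi.2 fun b => ?_
  rw [mem_closedBall_zero_iff]
  have h := hM.2 (Pi.single b 1)
  have hstar : star (Pi.single b 1 : F → 𝕜) = Pi.single b 1 := by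
    rw [← Pi.single_star, star_one]
  rw [hstar, single_one_dotProduct, single_one_dotProduct, mulVec_single_one, mulVec_single_one]
    at h
  simp only [Matrix.col_apply] at h
  have hMM : RCLike.re ((M * M) b b) = ∑ a, ‖M a b‖ ^ 2 := by
    rw [Matrix.mul_apply, map_sum]
    refine Finset.sum_congr rfl fun a _ => ?_
    rw [← hM.1.apply b a, RCLike.star_def, RCLike.conj_mul, ← RCLike.ofReal_pow, RCLike.ofReal_re]
  rw [hMM] at h
  refine Real.le_sqrt_of_sq_le (le_trans ?_ h)
  exact Finset.single_le_sum (f := fun a => ‖M a b‖ ^ 2) (fun _ _ => by positivity)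
    (Finset.mem_univ a)

lemma posSemidef_sub_of_mem_sqLeSet {B M : Matrix F F 𝕜} (hB : B.IsHermitian)
    (hM : M ∈ sqLeSet B) : (B - M * M).PosSemidef := by
  refine posSemidef_of_re (hB.sub (isHermitian_mul_self_of_isHermitian hM.1)) fun c => ?_
  rw [Matrix.sub_mulVec, dotProduct_sub, map_sub, sub_nonneg]
  exact hM.2 c

lemma compress_mem_sqLeSet [CompleteSpace H] {v : F → H} (hv : Orthonormal 𝕜 v)
    {S T : H →L[𝕜] H} (hS : IsSelfAdjoint S) (h : S ^ 2 ≤ T ^ 2) :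
    compress v S ∈ sqLeSet (compress v (T ^ 2)) := by
  refine ⟨isHermitian_compress v hS, fun c => ?_⟩
  have h1 := (RCLike.nonneg_iff.1 ((posSemidef_compress_sq_sub hv hS).dotProduct_mulVec_nonneg c)).1
  have h2 := (RCLike.nonneg_iff.1
    ((posSemidef_compress v ((ContinuousLinearMap.le_def _ _).1 h)).dotProduct_mulVec_nonneg c)).1
  rw [Matrix.sub_mulVec, dotProduct_sub, map_sub, sub_nonneg] at h1
  rw [compress_sub, Matrix.sub_mulVec, dotProduct_sub, map_sub, sub_nonneg] at h2
  exact h1.trans h2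

end Compression

/-! ### Spectrum, norm and quadratic forms on the Hilbert space -/

section Operators

variable {𝕜 H : Type*} [RCLike 𝕜] [NormedAddCommGroup H] [InnerProductSpace 𝕜 H]

/-- The strict reverse inequality defines a nonempty open set, which meets the dense span of the
basis; an element of that span uses finitely many basis vectors. -/
lemma exists_mem_span_of_not_forall {ι : Type*} (e : HilbertBasis ι 𝕜 H) {q : H → ℝ}
    (hq : Continuous q) {r : ℝ} (h : ¬ ∀ x, q x ≤ r * ‖x‖ ^ 2) :
    ∃ s : Finset ι, ∃ x ∈ Submodule.span 𝕜 (e '' (s : Set ι)), r * ‖x‖ ^ 2 < q x := by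
  classical
  push Not at h
  have hopen : IsOpen {x | r * ‖x‖ ^ 2 < q x} :=
    isOpen_lt (continuous_const.mul (continuous_norm.pow 2)) hq
  have hdense : Dense (Submodule.span 𝕜 (Set.range e) : Set H) :=
    Submodule.dense_iff_topologicalClosure_eq_top.2 e.dense_span
  obtain ⟨x, hx, hxs⟩ := hdense.inter_open_nonempty _ hopen h
  obtain ⟨t, ht, hxt⟩ := Submodule.mem_span_finite_of_mem_span hxs
  obtain ⟨s, rfl⟩ : ∃ s : Finset ι, s.image e = t := by
    rw [← Set.image_univ] at ht
    obtain ⟨s, -, hs⟩ := Finset.subset_set_image_iff.1 ht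
    exact ⟨s, hs⟩
  rw [Finset.coe_image] at hxt
  exact ⟨s, x, hxt, hx⟩

/-- Balls of radius 1/2 about the basis vectors are disjoint, as these lie at distance √2.
Countability permits continuity of measure along the finite subsets of the basis. -/
lemma countable_of_hilbertBasis [TopologicalSpace.SeparableSpace H] {ι : Type*}
    (e : HilbertBasis ι 𝕜 H) : Countable ι := by
  have hd : ∀ i j, i ≠ j → 1 ≤ dist (e i) (e j) := by
    intro i j hij
    have : ‖e i - e j‖ ^ 2 = 2 := by
      rw [@norm_sub_sq 𝕜, e.orthonormal.2 hij, e.orthonormal.1 i, e.orthonormal.1 j]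
      norm_num
    rw [dist_eq_norm]
    nlinarith [norm_nonneg (e i - e j)]
  have hdisj : (Set.univ : Set ι).PairwiseDisjoint fun i => Metric.ball (e i) (1 / 2) := by
    intro i _ j _ hij
    refine Metric.ball_disjoint_ball ?_
    have := hd i j hij
    linarith
  exact Set.countable_univ_iff.1 (hdisj.countable_of_isOpen (fun i _ => Metric.isOpen_ball)
    fun i _ => ⟨e i, Metric.mem_ball_self (by norm_num)⟩)

variable [CompleteSpace H]

/-- For t > r the operator t - T is coercive, hence invertible, so t is not in the spectrum. The
condition 0 ≤ r covers an empty spectrum, whose `sSup` is 0. -/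
lemma lambdaMax_le {T : H →L[𝕜] H} {r : ℝ} (hr : 0 ≤ r)
    (h : ∀ x, RCLike.re (inner 𝕜 x (T x)) ≤ r * ‖x‖ ^ 2) : lambdaMax T ≤ r := by
  refine Real.sSup_le (fun t ht => ?_) hr
  by_contra! hlt
  refine spectrum.mem_iff.1 ht ?_
  refine ContinuousLinearMap.isUnit_of_forall_le_norm_inner_map _
    (c := ⟨t - r, (sub_pos.2 hlt).le⟩) (sub_pos.2 hlt) fun x => ?_
  have h1 : RCLike.re (inner 𝕜 ((algebraMap 𝕜 (H →L[𝕜] H) (t : 𝕜) - T) x) x) =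
      t * ‖x‖ ^ 2 - RCLike.re (inner 𝕜 x (T x)) := by
    rw [inner_re_symm, _root_.sub_apply, inner_sub_right, map_sub,
      Algebra.algebraMap_eq_smul_one, _root_.smul_apply,
      one_apply_eq_self, inner_smul_right, inner_self_eq_norm_sq_to_K,
      ← RCLike.ofReal_pow, ← RCLike.ofReal_mul, RCLike.ofReal_re]
  refine le_trans ?_ (RCLike.re_le_norm _)
  rw [h1]
  change ‖x‖ ^ 2 * (t - r) ≤ _
  have := h x
  linarith

lemma norm_le_of_abs_inner_le {T : H →L[𝕜] H} (hT : IsSelfAdjoint T) {r : ℝ} (hr : 0 ≤ r)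
    (h : ∀ x, |RCLike.re (inner 𝕜 x (T x))| ≤ r * ‖x‖ ^ 2) : ‖T‖ ≤ r := by
  rw [ContinuousLinearMap.norm_eq_iSup_rayleighQuotient T hT.isSymmetric]
  refine Real.iSup_le (fun x => ?_) hr
  rw [ContinuousLinearMap.rayleighQuotient, ContinuousLinearMap.reApplyInnerSelf_apply,
    inner_re_symm, abs_div, abs_of_nonneg (sq_nonneg ‖x‖)]
  exact div_le_of_le_mul₀ (sq_nonneg _) hr (h x)

end Operators

/-! ### Compressions of the random operators -/

section CompressedVariables

open Matrix

variable {𝕜 H : Type*} [RCLike 𝕜] [NormedAddCommGroup H] [InnerProductSpace 𝕜 H]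
variable {F : Type*}
variable {Ω : Type*} [MeasurableSpace Ω] {P : Measure Ω}

lemma matExp_congr {Y Z : Ω → Matrix F F 𝕜} (h : ∀ᵐ ω ∂P, Y ω = Z ω) :
    matExp P Y = matExp P Z := by
  ext a b
  simp only [matExp, Matrix.of_apply]
  exact integral_congr_ae (h.mono fun ω hω => by simp only [hω])

lemma integrable_compress (v : F → H) {Z : Ω → H →L[𝕜] H} (hZ : Integrable Z P) (a b : F) :
    Integrable (fun ω => compress v (Z ω) a b) P :=
  ((innerSL 𝕜 (v a)).comp (ContinuousLinearMap.apply 𝕜 H (v b))).integrable_comp hZ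

section PosSemidef

variable [Fintype F]

lemma posSemidef_matExp {Z : Ω → Matrix F F 𝕜} (hint : ∀ a b, Integrable (fun ω => Z ω a b) P)
    (h : ∀ᵐ ω ∂P, (Z ω).PosSemidef) : (matExp P Z).PosSemidef := by
  refine posSemidef_of_re ?_ fun c => ?_
  · ext a b
    rw [Matrix.conjTranspose_apply]
    simp only [matExp, Matrix.of_apply]
    rw [RCLike.star_def, ← integral_conj]
    refine integral_congr_ae ?_
    filter_upwards [h] with ω hω
    exact hω.1.apply a b
  · have hi : ∀ a, Integrable (fun ω => ∑ b, Z ω a b * c b) P := fun a =>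
      integrable_finsetSum _ fun b _ => (hint a b).mul_const _
    have hI : Integrable (fun ω => ∑ a, star c a * ∑ b, Z ω a b * c b) P :=
      integrable_finsetSum _ fun a _ => (hi a).const_mul _
    have : star c ⬝ᵥ (matExp P Z *ᵥ c) = ∫ ω, ∑ a, star c a * ∑ b, Z ω a b * c b ∂P := by
      rw [integral_finsetSum _ fun a _ => (hi a).const_mul _]
      simp only [dotProduct, Matrix.mulVec, matExp, Matrix.of_apply]
      refine Finset.sum_congr rfl fun a _ => ?_
      rw [integral_const_mul, integral_finsetSum _ fun b _ => (hint a b).mul_const _]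
      simp_rw [integral_mul_const]
    rw [this, ← integral_re hI]
    refine integral_nonneg_of_ae ?_
    filter_upwards [h] with ω hω
    exact (RCLike.nonneg_iff.1 (hω.dotProduct_mulVec_nonneg c)).1

end PosSemidef

variable [CompleteSpace H] [NormedSpace ℝ H] [IsScalarTower ℝ 𝕜 H]

lemma matExp_compress (v : F → H) {Z : Ω → H →L[𝕜] H} (hZ : Integrable Z P) :
    matExp P (fun ω => compress v (Z ω)) = compress v (∫ ω, Z ω ∂P) := by
  ext a b
  exact ((innerSL 𝕜 (v a)).comp (ContinuousLinearMap.apply 𝕜 H (v b))).integral_comp_comm hZ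

lemma compress_varianceProxy {n : ℕ} (v : F → H) {X : Fin n → Ω → H →L[𝕜] H}
    (A : Fin n → H →L[𝕜] H) (hX : ∀ i, Integrable (fun ω => X i ω ^ 2) P) :
    compress v (varianceProxy P X A) = ((1 / 2 : ℝ) : 𝕜) •
      ∑ i, (compress v (A i ^ 2) + matExp P (fun ω => compress v (X i ω ^ 2))) := by
  -- The factor ½ acts through the separate real structure on H; it is identified here with a scalar
  -- of 𝕜.
  have h : varianceProxy P X A = ((1 / 2 : ℝ) : 𝕜) • ∑ i, (A i ^ 2 + ∫ ω, X i ω ^ 2 ∂P) := by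
    ext x
    rw [varianceProxy, _root_.smul_apply, _root_.smul_apply, RCLike.real_smul_eq_coe_smul (K := 𝕜)]
  rw [h, compress_smul, compress_sum]
  simp_rw [compress_add, matExp_compress v (hX _)]

variable [Fintype F] [IsProbabilityMeasure P]

/-- The compressions of the summands satisfy the hypotheses of the finite-dimensional bounds after
a modification on a null set. -/
lemma exists_compressed_variables {n : ℕ} {X : Fin n → Ω → H →L[𝕜] H} {A : Fin n → H →L[𝕜] H}
    (hX_meas : ∀ i, AEStronglyMeasurable (X i) P)
    (hX_selfAdjoint : ∀ i, ∀ᵐ ω ∂P, IsSelfAdjoint (X i ω))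
    (hX_indep : iIndepFun X P) (hX_centered : ∀ i, ∫ ω, X i ω ∂P = 0)
    (hA_selfAdjoint : ∀ i, IsSelfAdjoint (A i))
    (hXA : ∀ i, ∀ᵐ ω ∂P, X i ω ^ 2 ≤ A i ^ 2) {v : F → H} (hv : Orthonormal 𝕜 v) :
    (compress v (varianceProxy P X A)).IsHermitian ∧ ∃ Y : Fin n → Ω → Matrix F F 𝕜,
      (∀ i, IsBounded (Y i)) ∧ (∀ i ω, (Y i ω).IsHermitian) ∧ (∀ i, matExp P (Y i) = 0) ∧
      iIndepFun Y P ∧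
      (∀ ω, (compress v (varianceProxy P X A) - ((1 / 2 : ℝ) : 𝕜) •
        ∑ i, (Y i ω * Y i ω + matExp P (fun ω => Y i ω * Y i ω))).PosSemidef) ∧
      ∀ᵐ ω ∂P, ∀ i, Y i ω = compress v (X i ω) := by
  classical
  have hbd : ∀ i, ∀ᵐ ω ∂P, ‖X i ω‖ ≤ ‖A i‖ := fun i => by
    filter_upwards [hX_selfAdjoint i, hXA i] with ω h1 h2
    exact ContinuousLinearMap.opNorm_le_bound _ (norm_nonneg _) fun x =>
      (norm_apply_le_of_sq_le_sq h1 (hA_selfAdjoint i) h2 x).trans ((A i).le_opNorm x)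
  have hXint : ∀ i, Integrable (X i) P := fun i => Integrable.of_bound (hX_meas i) _ (hbd i)
  have hX2int : ∀ i, Integrable (fun ω => X i ω ^ 2) P := fun i => by
    refine Integrable.of_bound ((hX_meas i).pow 2) (‖A i‖ ^ 2) ?_
    filter_upwards [hbd i] with ω hω
    exact (norm_pow_le' _ two_pos).trans (pow_le_pow_left₀ (norm_nonneg _) hω 2)
  set B : Fin n → Matrix F F 𝕜 := fun i => compress v (A i ^ 2) with hB
  have hBpos : ∀ i, (B i).PosSemidef := fun i =>
    posSemidef_compress v (isPositive_sq_of_isSelfAdjoint (hA_selfAdjoint i))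
  -- Values outside the compact set are sent to 0, which lies in it. This changes the compression
  -- only on a null set, and makes the bounds hold everywhere. As `Y i` is almost surely a
  -- measurable function of `X i`, independence survives.
  set ρ : Fin n → Matrix F F 𝕜 → Matrix F F 𝕜 := fun i => (sqLeSet (B i)).indicator id with hρ
  have hρm : ∀ i, Measurable (ρ i) := fun i =>
    measurable_id.indicator (isClosed_sqLeSet (B i)).measurableSet
  have hzero : ∀ i, (0 : Matrix F F 𝕜) ∈ sqLeSet (B i) := fun i => by
    refine ⟨Matrix.isHermitian_zero, fun c => ?_⟩
    simpa using (RCLike.nonneg_iff.1 ((hBpos i).dotProduct_mulVec_nonneg c)).1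
  have hρmem : ∀ i M, ρ i M ∈ sqLeSet (B i) := fun i M => by
    by_cases hM : M ∈ sqLeSet (B i)
    · simp [hρ, hM]
    · simpa [hρ, hM] using hzero i
  set Y : Fin n → Ω → Matrix F F 𝕜 := fun i ω => ρ i (compress v ((hX_meas i).mk _ ω)) with hY
  have hYm : ∀ i, Measurable (Y i) := fun i => (hρm i).comp
    ((continuous_compress v).measurable.comp (hX_meas i).stronglyMeasurable_mk.measurable)
  have hYae : ∀ i, ∀ᵐ ω ∂P, Y i ω = compress v (X i ω) := fun i => by
    filter_upwards [hX_selfAdjoint i, hXA i, (hX_meas i).ae_eq_mk] with ω h1 h2 h3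
    rw [hY]
    simp only [hρ]
    rw [← h3, Set.indicator_of_mem (compress_mem_sqLeSet hv h1 h2), id]
  have hYB : ∀ i, IsBounded (Y i) := fun i =>
    ⟨hYm i, sqLeSet (B i), isCompact_sqLeSet _, fun ω => hρmem i _⟩
  have hYdiff : ∀ i ω, (B i - Y i ω * Y i ω).PosSemidef := fun i ω =>
    posSemidef_sub_of_mem_sqLeSet (hBpos i).1 (hρmem i _)
  have hX2pos : ∀ i, (matExp P fun ω => compress v (X i ω ^ 2)).PosSemidef := fun i => by
    refine posSemidef_matExp (integrable_compress v (hX2int i)) ?_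
    filter_upwards [hX_selfAdjoint i] with ω h1
    exact posSemidef_compress v (isPositive_sq_of_isSelfAdjoint h1)
  -- Bessel's inequality under the expectation: 𝔼 Yᵢ² is dominated by the compression of 𝔼 Xᵢ².
  have hM : ∀ i, ((matExp P fun ω => compress v (X i ω ^ 2)) -
      matExp P fun ω => Y i ω * Y i ω).PosSemidef := fun i => by
    have hYYint : ∀ a b, Integrable (fun ω => (Y i ω * Y i ω) a b) P := fun a b =>
      ((hYB i).mul (hYB i)).integrable_comp (f := fun M => M a b) (continuous_id.matrix_elem a b)
    have heq : (matExp P fun ω => compress v (X i ω ^ 2)) - (matExp P fun ω => Y i ω * Y i ω) =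
        matExp P fun ω => compress v (X i ω ^ 2) - Y i ω * Y i ω := by
      ext a b
      simp only [matExp, Matrix.of_apply, Matrix.sub_apply]
      rw [integral_sub (integrable_compress v (hX2int i) a b) (hYYint a b)]
    rw [heq]
    refine posSemidef_matExp
      (fun a b => (integrable_compress v (hX2int i) a b).sub (hYYint a b)) ?_
    filter_upwards [hX_selfAdjoint i, hYae i] with ω h1 h2
    rw [h2]
    exact posSemidef_compress_sq_sub hv h1
  have hhalf : (0 : 𝕜) ≤ ((1 / 2 : ℝ) : 𝕜) := RCLike.ofReal_nonneg.2 (by norm_num)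
  rw [compress_varianceProxy v A hX2int]
  refine ⟨((posSemidef_sum _ fun i _ => (hBpos i).add (hX2pos i)).smul hhalf).1,
    Y, hYB, fun i ω => (hρmem i _).1, fun i => ?_, ?_, fun ω => ?_, ae_all_iff.2 hYae⟩
  · rw [matExp_congr (hYae i), matExp_compress v (hXint i), hX_centered i]
    ext a b
    simp [compress]
  · refine iIndepFun.congr (fun i => ?_) (hX_indep.comp (fun i T => ρ i (compress v T))
      fun i => (hρm i).comp (continuous_compress v).measurable)
    filter_upwards [(hX_meas i).ae_eq_mk] with ω hω
    simp only [Function.comp_apply, hY]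
    rw [← hω]
  · rw [← smul_sub, ← Finset.sum_sub_distrib]
    refine (posSemidef_sum _ fun i _ => ?_).smul hhalf
    rw [add_sub_add_comm]
    exact (hYdiff i ω).add (hM i)

end CompressedVariables

/-! ### Passage to the limit and scalar optimisation -/

section Limits

variable {Ω : Type*} [MeasurableSpace Ω] {P : Measure Ω} [IsProbabilityMeasure P]

/-- Two limits: for q < r the increasing events exhaust `S` up to a null set, then q ↑ r. The gap
between q and r is needed because finite spans detect only strict inequalities. -/
lemma mul_measureReal_le_of_forall_lt {ι : Type*} [Countable ι] {E : ℝ → Finset ι → Set Ω}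
    (hE : ∀ q, Monotone (E q)) {S : Set Ω} {g : ℝ → ℝ} (hg : Continuous g) (hg0 : ∀ q, 0 ≤ g q)
    {r K : ℝ} (hr : 0 < r) (hS : ∀ q, 0 ≤ q → q < r → ∀ᵐ ω ∂P, ω ∈ S → ∃ s, ω ∈ E q s)
    (hb : ∀ q, 0 ≤ q → ∀ s, g q * P.real (E q s) ≤ K) : g r * P.real S ≤ K := by
  have h1 : ∀ q, 0 ≤ q → q < r → g q * P.real S ≤ K := by
    intro q hq hqr
    have hle : P.real S ≤ P.real (⋃ s, E q s) := by
      refine ENNReal.toReal_mono (measure_ne_top _ _) (measure_mono_ae ?_)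
      filter_upwards [hS q hq hqr] with ω hω hωS
      exact Set.mem_iUnion.2 (hω hωS)
    have hlim : Filter.Tendsto (fun s => g q * P.real (E q s)) Filter.atTop
        (nhds (g q * P.real (⋃ s, E q s))) :=
      ((ENNReal.tendsto_toReal (measure_ne_top _ _)).comp
        (tendsto_measure_iUnion_atTop (hE q))).const_mul _
    exact (mul_le_mul_of_nonneg_left hle (hg0 q)).trans
      (le_of_tendsto hlim (Filter.Eventually.of_forall fun s => hb q hq s))
  have hlim : Filter.Tendsto (fun q => g q * P.real S) (nhdsWithin r (Set.Iio r))
      (nhds (g r * P.real S)) :=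
    ((hg.tendsto r).mono_left nhdsWithin_le_nhds).mul_const _
  refine le_of_tendsto hlim ?_
  filter_upwards [self_mem_nhdsWithin, nhdsWithin_le_nhds (lt_mem_nhds hr)] with q h2 h3
  exact h1 q (le_of_lt h3) h2

/-- With y = exp(u/2), the claimed bound is at least 1 when (e - 1)y ≤ e. Otherwise (y - 1)(e - 1)y
≤ e(y² - 1 - u): the difference of the two sides is (y² - eu) + ((e - 1)y - e), and eu ≤ eᵘ = y². -/
lemma le_of_exp_remainder_mul_le {p τ u : ℝ} (hp : p ≤ 1) (hτ : 1 ≤ τ)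
    (h : (Real.exp u - 1 - u) * p ≤ τ * (Real.exp (u / 2) - 1)) :
    p ≤ Real.exp 1 / (Real.exp 1 - 1) * τ * Real.exp (-(u / 2)) := by
  set y := Real.exp (u / 2) with hy
  set E := Real.exp 1 with hE
  have hy0 : 0 < y := Real.exp_pos _
  have hE1 : 0 < E - 1 := by
    have := Real.add_one_lt_exp one_ne_zero
    linarith
  have hyy : Real.exp u = y ^ 2 := by rw [hy, ← Real.exp_nat_mul]; congr 1; push_cast; ring
  have hgoal : E / (E - 1) * τ * Real.exp (-(u / 2)) = E * τ / ((E - 1) * y) := by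
    rw [Real.exp_neg, ← hy]; field_simp
  rw [hgoal, le_div_iff₀ (mul_pos hE1 hy0)]
  rcases le_or_gt ((E - 1) * y) E with hle | hlt
  · have h1 : p * ((E - 1) * y) ≤ 1 * ((E - 1) * y) :=
      mul_le_mul_of_nonneg_right hp (mul_pos hE1 hy0).le
    have h2 : E * 1 ≤ E * τ := mul_le_mul_of_nonneg_left hτ (by linarith)
    linarith
  · have hu : E * u ≤ y ^ 2 := by
      have h1 := Real.add_one_le_exp (u - 1)
      have h2 : Real.exp u = Real.exp (u - 1) * E := by rw [hE, ← Real.exp_add]; simp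
      rw [← hyy, h2]
      have := mul_le_mul_of_nonneg_right h1 (by linarith : (0 : ℝ) ≤ E)
      linarith
    rw [hyy] at h
    have hkey : (y - 1) * ((E - 1) * y) ≤ E * (y ^ 2 - 1 - u) := by nlinarith
    have hy1 : 1 < y := by nlinarith
    have hpos : 0 < y ^ 2 - 1 - u := by
      have : 0 < (y - 1) * ((E - 1) * y) := by
        have := mul_pos hE1 hy0
        exact mul_pos (by linarith) this
      exact pos_of_mul_pos_right (this.trans_le hkey) (by linarith)
    refine le_of_mul_le_mul_left ?_ hpos
    calc (y ^ 2 - 1 - u) * (p * ((E - 1) * y)) = ((y ^ 2 - 1 - u) * p) * ((E - 1) * y) := by ring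
      _ ≤ (τ * (y - 1)) * ((E - 1) * y) :=
          mul_le_mul_of_nonneg_right h (mul_pos hE1 hy0).le
      _ = τ * ((y - 1) * ((E - 1) * y)) := by ring
      _ ≤ τ * (E * (y ^ 2 - 1 - u)) := mul_le_mul_of_nonneg_left hkey (by linarith)
      _ = _ := by ring

/-- With y = exp(u/2), the bound is trivial for y ≤ 2. For y > 2 one has y(y - 1) ≤ y² - 2 + exp(-u)
= 2(cosh u - 1). -/
lemma le_of_cosh_sub_one_mul_le {p τ u : ℝ} (hp : p ≤ 1) (hτ : 1 ≤ τ)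
    (h : (Real.cosh u - 1) * p ≤ τ * (Real.exp (u / 2) - 1)) :
    p ≤ 2 * τ * Real.exp (-(u / 2)) := by
  set y := Real.exp (u / 2) with hy
  have hy0 : 0 < y := Real.exp_pos _
  have hyy : Real.exp u = y ^ 2 := by rw [hy, ← Real.exp_nat_mul]; congr 1; push_cast; ring
  rw [Real.exp_neg, ← hy, ← div_eq_mul_inv, le_div_iff₀ hy0]
  rcases le_or_gt y 2 with hle | hlt
  · have h1 : p * y ≤ 1 * y := mul_le_mul_of_nonneg_right hp hy0.le
    linarith
  · have hcosh : y * (y - 1) ≤ 2 * (Real.cosh u - 1) := by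
      rw [Real.cosh_eq, hyy]
      have := Real.exp_pos (-u)
      nlinarith
    have hpos : 0 < Real.cosh u - 1 := by
      have : 0 < y * (y - 1) := mul_pos hy0 (by linarith)
      linarith
    refine le_of_mul_le_mul_left ?_ hpos
    calc (Real.cosh u - 1) * (p * y) = ((Real.cosh u - 1) * p) * y := by ring
      _ ≤ (τ * (y - 1)) * y := mul_le_mul_of_nonneg_right h hy0.le
      _ = τ * (y * (y - 1)) := by ring
      _ ≤ τ * (2 * (Real.cosh u - 1)) := mul_le_mul_of_nonneg_left hcosh (by linarith)
      _ = _ := by ring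

end Limits

/-! ### Tail bounds on the Hilbert space -/

section Main

variable {𝕜 H : Type*} [RCLike 𝕜] [NormedAddCommGroup H] [InnerProductSpace 𝕜 H] [CompleteSpace H]
variable [NormedSpace ℝ H] [IsScalarTower ℝ 𝕜 H]
variable {Ω : Type*} [MeasurableSpace Ω] {P : Measure Ω} [IsProbabilityMeasure P]

/-- Tail bounds for the quadratic forms of the partial sums on the span of finitely many vectors of
a Hilbert basis. -/
lemma mul_measureReal_exists_span_le {ι : Type*} (e : HilbertBasis ι 𝕜 H)
    {n : ℕ} {X : Fin n → Ω → H →L[𝕜] H} {A : Fin n → H →L[𝕜] H}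
    (hX_meas : ∀ i, AEStronglyMeasurable (X i) P)
    (hX_selfAdjoint : ∀ i, ∀ᵐ ω ∂P, IsSelfAdjoint (X i ω))
    (hX_indep : iIndepFun X P) (hX_centered : ∀ i, ∫ ω, X i ω ∂P = 0)
    (hA_selfAdjoint : ∀ i, IsSelfAdjoint (A i))
    (hXA : ∀ i, ∀ᵐ ω ∂P, X i ω ^ 2 ≤ A i ^ 2) {σ τ : ℝ}
    (hV_norm : ‖varianceProxy P X A‖ ≤ σ ^ 2) (s : Finset ι)
    (hV_trace : ∑ j ∈ s, RCLike.re (inner 𝕜 (e j) (varianceProxy P X A (e j))) ≤ τ * σ ^ 2)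
    {θ q : ℝ} (hθ : 0 ≤ θ) (hq : 0 ≤ q) :
    (Real.exp (θ * q) - 1 - θ * q) *
        P.real {ω | ∃ k, ∃ x ∈ Submodule.span 𝕜 (e '' (s : Set ι)),
          q * ‖x‖ ^ 2 < RCLike.re (inner 𝕜 x (partialSum X k ω x))} ≤
        τ * (Real.exp (θ ^ 2 * σ ^ 2 / 2) - 1) ∧
    (Real.cosh (θ * q) - 1) *
        P.real {ω | ∃ k, ∃ x ∈ Submodule.span 𝕜 (e '' (s : Set ι)),
          q * ‖x‖ ^ 2 < |RCLike.re (inner 𝕜 x (partialSum X k ω x))|} ≤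
        τ * (Real.exp (θ ^ 2 * σ ^ 2 / 2) - 1) := by
  classical
  set v : s → H := fun a => e a with hvdef
  have hv : Orthonormal 𝕜 v := e.orthonormal.comp _ Subtype.val_injective
  obtain ⟨hVH, Y, hYB, hYH, hY0, hYind, hYV, hYae⟩ := exists_compressed_variables hX_meas
    hX_selfAdjoint hX_indep hX_centered hA_selfAdjoint hXA hv
  set V := varianceProxy P X A with hVdef
  have hrange : e '' (s : Set ι) = Set.range v := by
    ext x; simp [hvdef]
  -- Compression does not increase the quadratic form bound, and its trace is a partial sum of the
  -- full trace. Hence σ and τ do not depend on `s`.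
  have hVσ : (((σ ^ 2 : ℝ) : 𝕜) • (1 : Matrix s s 𝕜) - compress v V).PosSemidef := by
    refine posSemidef_of_re (Matrix.IsHermitian.sub ?_ hVH) fun c => ?_
    · rw [Matrix.IsHermitian, Matrix.conjTranspose_smul, Matrix.conjTranspose_one,
        RCLike.star_def, RCLike.conj_ofReal]
    · rw [Matrix.sub_mulVec, dotProduct_sub, Matrix.smul_mulVec, Matrix.one_mulVec,
        dotProduct_smul, smul_eq_mul, star_dotProduct_self hv, star_dotProduct_compress_mulVec,
        map_sub, ← RCLike.ofReal_mul, RCLike.ofReal_re, sub_nonneg]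
      set x := ∑ b, c b • v b
      calc RCLike.re (inner 𝕜 x (V x)) ≤ ‖x‖ * ‖V x‖ := re_inner_le_norm _ _
        _ ≤ ‖x‖ * (‖V‖ * ‖x‖) := by gcongr; exact V.le_opNorm x
        _ ≤ ‖x‖ * (σ ^ 2 * ‖x‖) := by gcongr
        _ = σ ^ 2 * ‖x‖ ^ 2 := by ring
  have hVτ : rtr (compress v V) ≤ τ * σ ^ 2 := by
    refine le_trans (le_of_eq ?_) hV_trace
    rw [rtr, Matrix.trace, map_sum, ← Finset.sum_coe_sort s]
    rfl
  have hform : ∀ᵐ ω ∂P, ∀ k (c : s → 𝕜),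
      dotProduct (star c) (Matrix.mulVec (∑ j ∈ Finset.Iic k, Y j ω) c) =
        inner 𝕜 (∑ b, c b • v b) (partialSum X k ω (∑ b, c b • v b)) := by
    filter_upwards [hYae] with ω hω k c
    simp_rw [hω]
    rw [← compress_sum, star_dotProduct_compress_mulVec, partialSum]
  refine ⟨le_trans (mul_le_mul_of_nonneg_left ?_ (exp_sub_one_sub_nonneg _))
    (measureReal_exists_eigenvalue_mul_le hYB hYH hY0 hYind hYV hVσ hVτ hθ hq),
    le_trans (mul_le_mul_of_nonneg_left ?_ (sub_nonneg.2 (Real.one_le_cosh _)))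
    (measureReal_exists_abs_eigenvalue_mul_le hYB hYH hY0 hYind hYV hVσ hVτ θ hq)⟩
  all_goals
    refine ENNReal.toReal_mono (measure_ne_top _ _) (measure_mono_ae ?_)
    filter_upwards [hform] with ω hω
    rintro ⟨k, x, hx, hlt⟩
    rw [hrange, Submodule.mem_span_range_iff_exists_fun] at hx
    obtain ⟨c, rfl⟩ := hx
    refine ⟨k, c, ?_⟩
    rw [hω k c, star_dotProduct_self hv, RCLike.ofReal_re]
    exact hlt

/-- Positivity of r excludes n = 0, where the supremum is 0 by default. -/
lemma exists_le_of_le_ciSup {n : ℕ} {f : Fin n → ℝ} {r : ℝ} (hr : 0 < r) (h : r ≤ ⨆ i, f i) :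
    ∃ i, r ≤ f i := by
  rcases isEmpty_or_nonempty (Fin n) with hn | hn
  · rw [Real.iSup_of_isEmpty] at h
    exact absurd h (not_le.2 hr)
  · obtain ⟨i, hi⟩ := exists_eq_ciSup_of_finite (f := f)
    exact ⟨i, hi ▸ h⟩

/-- The tail bounds in terms of real-valued quantities. -/
lemma measureReal_iSup_le [TopologicalSpace.SeparableSpace H] {ι : Type*} (e : HilbertBasis ι 𝕜 H)
    {n : ℕ} {X : Fin n → Ω → H →L[𝕜] H} {A : Fin n → H →L[𝕜] H}
    (hX_meas : ∀ i, AEStronglyMeasurable (X i) P)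
    (hX_selfAdjoint : ∀ i, ∀ᵐ ω ∂P, IsSelfAdjoint (X i ω))
    (hX_indep : iIndepFun X P) (hX_centered : ∀ i, ∫ ω, X i ω ∂P = 0)
    (hA_selfAdjoint : ∀ i, IsSelfAdjoint (A i))
    (hXA : ∀ i, ∀ᵐ ω ∂P, X i ω ^ 2 ≤ A i ^ 2) {σ τ : ℝ} (hσ : 0 < σ) (hτ : 1 ≤ τ)
    (hV_norm : ‖varianceProxy P X A‖ ≤ σ ^ 2)
    (hV_trace : ∀ s : Finset ι,
      ∑ j ∈ s, RCLike.re (inner 𝕜 (e j) (varianceProxy P X A (e j))) ≤ τ * σ ^ 2)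
    {r : ℝ} (hr : 0 ≤ r) :
    P.real {ω | r ≤ ⨆ i, lambdaMax (partialSum X i ω)} ≤
      Real.exp 1 / (Real.exp 1 - 1) * τ * Real.exp (-(r ^ 2 / (2 * σ ^ 2))) ∧
    P.real {ω | r ≤ ⨆ i, ‖partialSum X i ω‖} ≤ 2 * τ * Real.exp (-(r ^ 2 / (2 * σ ^ 2))) := by
  have hcount : Countable ι := countable_of_hilbertBasis e
  -- This θ minimises θ²σ²/2 - θr, so that θr = u and θ²σ²/2 = u/2.
  set θ := r / σ ^ 2 with hθdef
  set u := r ^ 2 / σ ^ 2 with hudef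
  have hθ : 0 ≤ θ := by positivity
  have hθr : θ * r = u := by rw [hθdef, hudef]; ring
  have hθσ : θ ^ 2 * σ ^ 2 / 2 = u / 2 := by rw [hθdef, hudef]; field_simp
  have hu2 : r ^ 2 / (2 * σ ^ 2) = u / 2 := by rw [hudef]; field_simp
  have hSA : ∀ᵐ ω ∂P, ∀ k, IsSelfAdjoint (partialSum X k ω) := by
    filter_upwards [ae_all_iff.2 hX_selfAdjoint] with ω hω k
    exact isSelfAdjoint_sum _ fun j _ => hω j
  have hcontq : ∀ T : H →L[𝕜] H, Continuous fun x => RCLike.re (inner 𝕜 x (T x)) := fun T =>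
    RCLike.continuous_re.comp (continuous_id.inner T.continuous)
  have hspan : ∀ s t : Finset ι, s ≤ t → Submodule.span 𝕜 (e '' (s : Set ι)) ≤
      Submodule.span 𝕜 (e '' (t : Set ι)) := fun s t hst =>
    Submodule.span_mono (Set.image_mono (Finset.coe_subset.2 hst))
  have hbound := fun (q : ℝ) (hq : 0 ≤ q) (s : Finset ι) => mul_measureReal_exists_span_le e hX_meas
    hX_selfAdjoint hX_indep hX_centered hA_selfAdjoint hXA hV_norm s (hV_trace s) hθ hq
  rw [hu2]
  constructor
  · refine le_of_exp_remainder_mul_le measureReal_le_one hτ ?_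
    -- At r = 0 both sides vanish; the limit q ↑ r through nonnegative q needs r > 0.
    rcases hr.eq_or_lt with h0 | hr
    · simp [hudef, ← h0]
    rw [← hθσ, ← hθr]
    refine mul_measureReal_le_of_forall_lt (P := P)
      (E := fun q (s : Finset ι) => {ω | ∃ k, ∃ x ∈ Submodule.span 𝕜 (e '' (s : Set ι)),
        q * ‖x‖ ^ 2 < RCLike.re (inner 𝕜 x (partialSum X k ω x))})
      (S := {ω | r ≤ ⨆ i, lambdaMax (partialSum X i ω)})
      (g := fun q => Real.exp (θ * q) - 1 - θ * q) ?_ (by fun_prop)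
      (fun q => exp_sub_one_sub_nonneg _) hr ?_ ?_
    · rintro q s t hst ω ⟨k, x, hx, hlt⟩
      exact ⟨k, x, hspan s t hst hx, hlt⟩
    · intro q hq hqr
      refine Filter.Eventually.of_forall fun ω hω => ?_
      obtain ⟨k, hk⟩ := exists_le_of_le_ciSup hr hω
      obtain ⟨s, x, hx, hlt⟩ := exists_mem_span_of_not_forall e (hcontq (partialSum X k ω))
        fun h => (hk.trans (lambdaMax_le hq h)).not_gt hqr
      exact ⟨s, k, x, hx, hlt⟩
    · intro q hq s
      exact (hbound q hq s).1
  · refine le_of_cosh_sub_one_mul_le measureReal_le_one hτ ?_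
    rcases hr.eq_or_lt with h0 | hr
    · simp [hudef, ← h0]
    rw [← hθσ, ← hθr]
    refine mul_measureReal_le_of_forall_lt (P := P)
      (E := fun q (s : Finset ι) => {ω | ∃ k, ∃ x ∈ Submodule.span 𝕜 (e '' (s : Set ι)),
        q * ‖x‖ ^ 2 < |RCLike.re (inner 𝕜 x (partialSum X k ω x))|})
      (S := {ω | r ≤ ⨆ i, ‖partialSum X i ω‖})
      (g := fun q => Real.cosh (θ * q) - 1) ?_
      ((Real.continuous_cosh.comp (continuous_const.mul continuous_id)).sub continuous_const)
      (fun q => sub_nonneg.2 (Real.one_le_cosh _)) hr ?_ ?_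
    · rintro q s t hst ω ⟨k, x, hx, hlt⟩
      exact ⟨k, x, hspan s t hst hx, hlt⟩
    · intro q hq hqr
      filter_upwards [hSA] with ω hSAω hω
      obtain ⟨k, hk⟩ := exists_le_of_le_ciSup hr hω
      obtain ⟨s, x, hx, hlt⟩ := exists_mem_span_of_not_forall e (hcontq (partialSum X k ω)).abs
        fun h => (hk.trans (norm_le_of_abs_inner_le (hSAω k) hq h)).not_gt hqr
      exact ⟨s, k, x, hx, hlt⟩
    · intro q hq s
      exact (hbound q hq s).2

end Main

end OperatorHoeffding

theorem mainTheorem4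
    {𝕜 : Type*} [RCLike 𝕜]
    {H : Type*} [NormedAddCommGroup H] [InnerProductSpace 𝕜 H] [CompleteSpace H]
    [TopologicalSpace.SeparableSpace H]
    [NormedSpace ℝ H] [IsScalarTower ℝ 𝕜 H]
    {ι : Type*} (e : HilbertBasis ι 𝕜 H)
    {Ω : Type*} [MeasurableSpace Ω] (P : Measure Ω) [IsProbabilityMeasure P]
    (n : ℕ) (X : Fin n → Ω → H →L[𝕜] H) (A : Fin n → H →L[𝕜] H)
    (hX_meas : ∀ i, AEStronglyMeasurable (X i) P)
    (hX_compact : ∀ i, ∀ᵐ ω ∂P, IsCompactOperator (X i ω))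
    (hX_selfAdjoint : ∀ i, ∀ᵐ ω ∂P, IsSelfAdjoint (X i ω))
    (hX_indep : iIndepFun X P)
    (hX_centered : ∀ i, ∫ ω, X i ω ∂P = 0)
    (hA_selfAdjoint : ∀ i, IsSelfAdjoint (A i))
    (hXA : ∀ i, ∀ᵐ ω ∂P, X i ω ^ 2 ≤ A i ^ 2)
    (σ : ℝ) (hσ : 0 < σ)
    (hV_norm : ‖OperatorHoeffding.varianceProxy P X A‖ ≤ σ ^ 2)
    (hV_trace : ENNReal.ofReal (σ ^ 2) ≤
      OperatorHoeffding.posTrace e (OperatorHoeffding.varianceProxy P X A))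
    (r : ℝ) (hr : 0 ≤ r) :
    P {ω | r ≤ ⨆ i, OperatorHoeffding.lambdaMax (OperatorHoeffding.partialSum X i ω)} ≤
        ENNReal.ofReal (Real.exp 1 / (Real.exp 1 - 1)) *
          (OperatorHoeffding.posTrace e (OperatorHoeffding.varianceProxy P X A) /
            ENNReal.ofReal (σ ^ 2)) *
          ENNReal.ofReal (Real.exp (-(r ^ 2 / (2 * σ ^ 2)))) ∧
    P {ω | r ≤ ⨆ i, ‖OperatorHoeffding.partialSum X i ω‖} ≤
        2 * (OperatorHoeffding.posTrace e (OperatorHoeffding.varianceProxy P X A) /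
            ENNReal.ofReal (σ ^ 2)) *
          ENNReal.ofReal (Real.exp (-(r ^ 2 / (2 * σ ^ 2)))) := by
  set t := OperatorHoeffding.posTrace e (OperatorHoeffding.varianceProxy P X A) with ht
  have hσ2 : 0 < σ ^ 2 := by positivity
  have hE1 : 0 < Real.exp 1 - 1 := by
    have := Real.add_one_lt_exp one_ne_zero
    linarith
  have hEE : 0 < Real.exp 1 / (Real.exp 1 - 1) := div_pos (Real.exp_pos _) hE1
  -- An infinite trace makes both right-hand sides infinite. Otherwise τ = t/σ² is a real number, at
  -- least 1 by the lower bound on the trace.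
  rcases eq_or_ne t ⊤ with htop | hfin
  · have hdiv : t / ENNReal.ofReal (σ ^ 2) = ⊤ := by
      rw [htop]; exact ENNReal.top_div_of_ne_top ENNReal.ofReal_ne_top
    have hexp : ENNReal.ofReal (Real.exp (-(r ^ 2 / (2 * σ ^ 2)))) ≠ 0 :=
      (ENNReal.ofReal_pos.2 (Real.exp_pos _)).ne'
    rw [hdiv, ENNReal.mul_top (ENNReal.ofReal_pos.2 hEE).ne', ENNReal.mul_top two_ne_zero,
      ENNReal.top_mul hexp]
    exact ⟨le_top, le_top⟩
  · have hτσ : t.toReal / σ ^ 2 * σ ^ 2 = t.toReal := div_mul_cancel₀ _ hσ2.ne'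
    have hτ : 1 ≤ t.toReal / σ ^ 2 := by
      rw [le_div_iff₀ hσ2, one_mul]
      exact (ENNReal.ofReal_le_iff_le_toReal hfin).1 hV_trace
    have htrace : ∀ s : Finset ι,
        ∑ j ∈ s, RCLike.re (inner 𝕜 (e j) (OperatorHoeffding.varianceProxy P X A (e j))) ≤
          t.toReal / σ ^ 2 * σ ^ 2 := by
      intro s
      rw [hτσ]
      calc ∑ j ∈ s, RCLike.re (inner 𝕜 (e j) (OperatorHoeffding.varianceProxy P X A (e j)))
          ≤ ∑ j ∈ s, (ENNReal.ofReal
              (RCLike.re (inner 𝕜 (e j) (OperatorHoeffding.varianceProxy P X A (e j))))).toReal :=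
            Finset.sum_le_sum fun j _ => by
              rw [ENNReal.toReal_ofReal']; exact le_max_left _ _
        _ = (∑ j ∈ s, ENNReal.ofReal
              (RCLike.re (inner 𝕜 (e j) (OperatorHoeffding.varianceProxy P X A (e j))))).toReal :=
            (ENNReal.toReal_sum fun _ _ => ENNReal.ofReal_ne_top).symm
        _ ≤ t.toReal := ENNReal.toReal_mono hfin (ENNReal.sum_le_tsum s)
    obtain ⟨h1, h2⟩ := OperatorHoeffding.measureReal_iSup_le e hX_meas hX_selfAdjoint hX_indep hX_centered
      hA_selfAdjoint hXA hσ hτ hV_norm htrace hr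
    have hdiv : t / ENNReal.ofReal (σ ^ 2) = ENNReal.ofReal (t.toReal / σ ^ 2) := by
      rw [ENNReal.ofReal_div_of_pos hσ2, ENNReal.ofReal_toReal hfin]
    have htwo : (2 : ℝ≥0∞) = ENNReal.ofReal 2 := by simp
    rw [hdiv, htwo, ← ENNReal.ofReal_mul hEE.le, ← ENNReal.ofReal_mul (by positivity),
      ← ENNReal.ofReal_mul two_pos.le, ← ENNReal.ofReal_mul (by positivity)]
    exact ⟨(ENNReal.le_ofReal_iff_toReal_le (measure_ne_top _ _) (by positivity)).2 h1,
      (ENNReal.le_ofReal_iff_toReal_le (measure_ne_top _ _) (by positivity)).2 h2⟩
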